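/- Let $\mathcal S,\mathcal A$ be finite non-empty sets, $P(\cdot\mid s,a)$ a transition matrix, $\rho$ an initial distribution on $\mathcal S$, $\gamma\in[0,1)$, $d\ge 1$, and let $r,c_1,\dots,c_d:\mathcal S\times\mathcal A\to[0,1]$ be a reward and constraint rewards. For a stationary randomized policy $\pi$, a transition matrix $p$ and a reward $l$, the value from $\mu$ is $\mathbb E\big[\sum_{t\ge0}\gamma^t l(s_t,a_t)\big]$ with $s_0\sim\mu$, $a_t\sim\pi(\cdot\mid s_t)$, $s_{t+1}\sim p(\cdot\mid s_t,a_t)$. Write $V^\pi_l(\mu)$ for $p=P$ and $\hat V^\pi_l(\mu)$ for $p=\hat P$ (defined below). Let $\omega\in(0,1]$, $0<\varepsilon_1<U$ with $U/\varepsilon_1\in\mathbb N$, $\Lambda=\{0,\varepsilon_1,2\varepsilon_1,\dots,U\}$, $b'\in\mathbb R^d$, $\eta\in\mathbb R$, $T\ge1$ and $N\in\mathbb N$. The model-based primal-dual algorithm draws $N$ samples from $P(\cdot\mid s,a)$ for every $(s,a)$, sets $\hat P(s'\mid s,a)$ to be the fraction of them that equal $s'$, and draws $\xi(s,a)\sim\mathrm{Unif}[0,\omega]$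 for every $(s,a)$, everything independent; it sets $r_p=r+\xi$. Starting from $\lambda_0=0\in\mathbb R^d$, for $t=0,\dots,T-1$ it takes $\hat\pi_t$ to be an optimal stationary policy of the unconstrained MDP with transition matrix $\hat P$ and reward $r_p+\sum_i\lambda_{t,i}c_i$ (optimal from every state), and $\lambda_{t+1,i}$ to be an element of $\Lambda$ closest to the projection of $\lambda_{t,i}-\eta\big(\hat V^{\hat\pi_t}_{c_i}(\rho)-b'_i\big)$ on $[0,U]$; ties are broken arbitrarily. It outputs the mixture policy $\bar\pi_T$ which follows $\hat\pi_t$ with $t$ uniform on $\{0,\dots,T-1\}$, so that $V^{\bar\pi_T}_l(\rho)=\frac1T\sum_{t<T}V^{\hat\pi_t}_l(\rho)$ and $\hat V^{\bar\pi_T}_l(\rho)=\frac1T\sum_{t<T}\hat V^{\hat\pi_t}_l(\rho)$. Let $\delta\in(0,1)$, $$\iota=\frac{\omega\,\delta\,(1-\gamma)\,\varepsilon_1^d}{30\,U^d\,|\mathcal S|\,|\mathcal A|^2},\qquad C(\delta')=72\log\!\left(\frac{16\,(1+\omega+dU)\,|\mathcal S|\,|\mathcal A|\,\log\frac{e}{1-\gamma}}{(1-\gamma)^2\,\iota\,\delta'}\right)\quad(\delta'>0,\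 \iota\text{ fixed}).$$ If $N\ge\frac{4\,C(\delta/d)}{1-\gamma}$, then with probability at least $1-\delta/5$, simultaneously $$\big|V^{\bar\pi_T}_{r_p}(\rho)-\hat V^{\bar\pi_T}_{r_p}(\rho)\big|\le 2\sqrt{\frac{C(\delta)}{N(1-\gamma)^3}}\quad\text{and}\quad \big|V^{\bar\pi_T}_{c_i}(\rho)-\hat V^{\bar\pi_T}_{c_i}(\rho)\big|\le\sqrt{\frac{C(\delta/d)}{N(1-\gamma)^3}}\ \text{ for every } i=1,\dots,d.$$ -/

import Mathlib

open MeasureTheory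

noncomputable section

namespace CMDP

/-! Finite Markov decision processes with states `S` and actions `A`.  Transition matrices and
stationary policies are given by their real probabilities `p s a s'` and `π s a`. -/

/-- A stationary (randomized) policy: a probability vector on the actions for every state. -/
def IsPolicy {S A : Type*} [Fintype A] (π : S → A → ℝ) : Prop :=
  ∀ s, π s ∈ stdSimplex ℝ A

/-- The law of the state `s_t`, when `s_0 ∼ μ`, `a_t ∼ π(· | s_t)`, `s_{t+1} ∼ p(· | s_t, a_t)`. -/
def stateLaw {S A : Type*} [Fintype S] [Fintype A]
    (p : S → A → S → ℝ) (π : S → A → ℝ) (μ : S → ℝ) : ℕ → S → ℝ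
  | 0 => μ
  | t + 1 => fun s' => ∑ s, ∑ a, stateLaw p π μ t s * π s a * p s a s'

/-- The value `V_l^π(μ) = ∑_t γ^t E[l(s_t, a_t)]` of the policy `π` for the reward `l`,
from the initial distribution `μ`. -/
def value {S A : Type*} [Fintype S] [Fintype A]
    (p : S → A → S → ℝ) (γ : ℝ) (π l : S → A → ℝ) (μ : S → ℝ) : ℝ :=
  ∑' t : ℕ, γ ^ t * ∑ s, ∑ a, stateLaw p π μ t s * π s a * l s a

/-- `π` is an optimal policy of the unconstrained MDP with reward `f`: it maximizes the value
function among all stationary policies, at every state (hence also from every initial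
distribution). -/
def IsOptimalPolicy {S A : Type*} [Fintype S] [DecidableEq S] [Fintype A]
    (p : S → A → S → ℝ) (γ : ℝ) (f π : S → A → ℝ) : Prop :=
  IsPolicy π ∧ ∀ π' : S → A → ℝ, IsPolicy π' →
    ∀ s, value p γ π' f (Pi.single s 1) ≤ value p γ π f (Pi.single s 1)

/-- The random input of the algorithm: `N` sampled next states for every state-action pair, and
the reward perturbations. -/
abbrev Sample (S A : Type*) (N : ℕ) : Type _ :=
  (S → A → Fin N → S) × (S → A → ℝ)

/-- The law of the random input: all samples and perturbations are independent, the samples at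
`(s, a)` have law `P(· | s, a)` and the perturbations are uniform on `[0, ω]`. -/
def sampleMeasure {S A : Type*} [Fintype S] [Fintype A] [MeasurableSpace S]
    (P : S → A → PMF S) (N : ℕ) (ω : ℝ) : Measure (Sample S A N) :=
  (Measure.pi fun s : S => Measure.pi fun a : A => Measure.pi fun _ : Fin N =>
      (P s a).toMeasure).prod
    (Measure.pi fun _ : S => Measure.pi fun _ : A =>
      ProbabilityTheory.cond (volume : Measure ℝ) (Set.Icc 0 ω))

/-- The real transition probabilities of a transition matrix. -/
def trueKernel {S A : Type*} (P : S → A → PMF S) : S → A → S → ℝ :=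
  fun s a s' => (P s a s').toReal

/-- The empirical transition matrix `N(s' | s, a) / N`. -/
def empKernel {S A : Type*} [DecidableEq S] {N : ℕ} (x : S → A → Fin N → S) :
    S → A → S → ℝ :=
  fun s a s' => ((Finset.univ.filter fun j : Fin N => x s a j = s').card : ℝ) / N

/-- The net `{0, ε, 2ε, …, U}` (used when `U` is a multiple of `ε`). -/
def net (U ε : ℝ) : Set ℝ :=
  {y | ∃ k : ℕ, y = k * ε ∧ y ≤ U}

/-- `y` is a closest element of the net to `x`. -/
def IsRounding (U ε x y : ℝ) : Prop :=
  y ∈ net U ε ∧ ∀ z ∈ net U ε, |y - x| ≤ |z - x|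

/-- `π 0, …, π (T - 1)` and `lam 0, …, lam T` are the iterates of a run of the primal-dual
algorithm on the empirical model with transition matrix `p`, perturbed reward `rp`,
constraint rewards `c`, thresholds `b'`, and step size `η`.  Ties, in the choice of an optimal
policy and in rounding, may be broken in any way. -/
structure IsRun {S A : Type*} [Fintype S] [DecidableEq S] [Fintype A] {d : ℕ}
    (p : S → A → S → ℝ) (γ : ℝ) (ρ : S → ℝ) (rp : S → A → ℝ) (c : Fin d → S → A → ℝ)
    (b' : Fin d → ℝ) (U ε η : ℝ) (T : ℕ)
    (π : ℕ → S → A → ℝ) (lam : ℕ → Fin d → ℝ) : Prop where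
  init : lam 0 = 0
  primal : ∀ t < T,
    IsOptimalPolicy p γ (fun s a => rp s a + ∑ i, lam t i * c i s a) (π t)
  dual : ∀ t < T, ∀ i,
    IsRounding U ε (max 0 (min U (lam t i - η * (value p γ (π t) (c i) ρ - b' i))))
      (lam (t + 1) i)

/-- The value of the mixture policy, which draws `t` uniformly from `{0, …, T - 1}` and then
follows `π t`. -/
def mixtureValue {S A : Type*} [Fintype S] [Fintype A]
    (p : S → A → S → ℝ) (γ : ℝ) (T : ℕ) (π : ℕ → S → A → ℝ) (l : S → A → ℝ) (μ : S → ℝ) : ℝ :=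
  1 / (T : ℝ) * ∑ t ∈ Finset.range T, value p γ (π t) l μ

/-- The gap `ι`, for `nS` states, `nA` actions and `d` constraints. -/
def gap (nS nA d : ℕ) (γ ω U ε δ : ℝ) : ℝ :=
  ω * δ * (1 - γ) * ε ^ d / (30 * U ^ d * nS * (nA : ℝ) ^ 2)

/-- The logarithmic factor `C(δ)`, for a given value `ι` of the gap. -/
def logFactor (nS nA d : ℕ) (γ ω U ι δ : ℝ) : ℝ :=
  72 * Real.log (16 * (1 + ω + d * U) * nS * nA * Real.log (Real.exp 1 / (1 - γ)) /
    ((1 - γ) ^ 2 * ι * δ))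

end CMDP

end

open MeasureTheory

noncomputable section

namespace CMDP

/-! Two obstacles have to be overcome. The policies of the run depend on the same samples as the
empirical model, so concentration cannot be applied to their values directly; and a crude simulation
bound has a worse power of `1 / (1 - γ)` than `3 / 2`.

Decoupling. The multipliers take at most `(U / ε₁ + 1) ^ d` values, so only finitely many objectives
occur. Raising the perturbation at `(s, a)` by `Δ` raises the difference of the optimal action
values of `a` and any other action at `s` by at least `(1 - γ) Δ` (`IsOptValue.expand`), so with
high probability all these differences exceed some `g > 0` in absolute value
(`measure_not_hasGap_le`). Under this gap the optimal policy is unique and deterministic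
(`IsOptimalPolicy.eq_detPolicy`), so ties are irrelevant. It is also stable: for every `(s, a)` it
stays greedy when the row at `(s, a)` is replaced by a self-loop whose reward is a suitable number
rounded to a grid (`IsGreedy.eq_of_absorb`). The modified models do not see the samples at `(s, a)`,
so the policy belongs to a short list that is independent of that row. Bernstein's inequality and a
union bound over the list apply (`measure_greedy_not_rowGood_le`).

Horizon. Bernstein's inequality is used for the true value function `v` of the policy and for `v ^
2`. On the resulting event the argument is deterministic (`abs_sub_le_of_rowGood`): if `w` is the
empirical value, adding a small multiple of `v ^ 2` to `±(w - v)` absorbs the variance terms, and a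
discounted recursion bounds the sum. The error has order `b η` with `b = 1 / (1 - γ)` and `η ^ 2` of
order `C b / N`, which is the rate claimed. -/

section

/-! ### Values of stationary policies and the Bellman equation. -/

variable {S A : Type*} [Fintype S] [Fintype A]

/-- A transition matrix: a probability vector on the next states for every state and action. -/
def IsKernel (p : S → A → S → ℝ) : Prop :=
  ∀ s a, p s a ∈ stdSimplex ℝ S

/-- The action value of `(s, a)` when the future is worth `V`. -/
def actionValue (p : S → A → S → ℝ) (γ : ℝ) (f : S → A → ℝ) (V : S → ℝ) (s : S) (a : A) : ℝ :=
  f s a + γ * ∑ s', p s a s' * V s'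

lemma stateLaw_mem {p : S → A → S → ℝ} (hp : IsKernel p) {π : S → A → ℝ} (hπ : IsPolicy π)
    {μ : S → ℝ} (hμ : μ ∈ stdSimplex ℝ S) (t : ℕ) : stateLaw p π μ t ∈ stdSimplex ℝ S := by
  induction t with
  | zero => exact hμ
  | succ t ih =>
    refine ⟨fun s' => Finset.sum_nonneg fun s _ => Finset.sum_nonneg fun a _ =>
      mul_nonneg (mul_nonneg (ih.1 s) ((hπ s).1 a)) ((hp s a).1 s'), ?_⟩
    simp only [stateLaw]
    rw [Finset.sum_comm, ← ih.2]
    refine Finset.sum_congr rfl fun s _ => ?_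
    rw [Finset.sum_comm]
    simp_rw [← Finset.mul_sum, (hp s _).2, mul_one]
    rw [← Finset.mul_sum, (hπ s).2, mul_one]

/-- The recursion defining `stateLaw` appends a step at the end; the Bellman equation needs the
first step split off. -/
lemma stateLaw_succ' (p : S → A → S → ℝ) (π : S → A → ℝ) (μ : S → ℝ) (t : ℕ) :
    stateLaw p π μ (t + 1) = stateLaw p π (stateLaw p π μ 1) t := by
  induction t with
  | zero => rfl
  | succ t ih =>
    rw [stateLaw, ih]
    rfl

lemma stateLaw_eq_sum [DecidableEq S] (p : S → A → S → ℝ) (π : S → A → ℝ) (μ : S → ℝ) (t : ℕ)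
    (s' : S) : stateLaw p π μ t s' = ∑ s, μ s * stateLaw p π (Pi.single s 1) t s' := by
  induction t generalizing s' with
  | zero => simp [stateLaw, Pi.single_apply]
  | succ t ih =>
    simp only [stateLaw, Finset.mul_sum]
    conv_rhs => rw [Finset.sum_comm]
    refine Finset.sum_congr rfl fun s _ => ?_
    conv_rhs => rw [Finset.sum_comm]
    refine Finset.sum_congr rfl fun a _ => ?_
    rw [ih, Finset.sum_mul, Finset.sum_mul]
    exact Finset.sum_congr rfl fun _ _ => by ring

lemma abs_reward_le {p : S → A → S → ℝ} (hp : IsKernel p) {π : S → A → ℝ} (hπ : IsPolicy π)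
    {μ : S → ℝ} (hμ : μ ∈ stdSimplex ℝ S) (l : S → A → ℝ) (t : ℕ) :
    |∑ s, ∑ a, stateLaw p π μ t s * π s a * l s a| ≤ ∑ s, ∑ a, |l s a| := by
  refine (Finset.abs_sum_le_sum_abs _ _).trans (Finset.sum_le_sum fun s _ =>
    (Finset.abs_sum_le_sum_abs _ _).trans (Finset.sum_le_sum fun a _ => ?_))
  have h1 := stateLaw_mem hp hπ hμ t
  have h2 : stateLaw p π μ t s ≤ 1 := h1.2 ▸
    Finset.single_le_sum (fun i _ => h1.1 i) (Finset.mem_univ s)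
  have h3 : π s a ≤ 1 := (hπ s).2 ▸
    Finset.single_le_sum (fun i _ => (hπ s).1 i) (Finset.mem_univ a)
  rw [abs_mul, abs_of_nonneg (mul_nonneg (h1.1 s) ((hπ s).1 a))]
  exact mul_le_of_le_one_left (abs_nonneg _) (mul_le_one₀ h2 ((hπ s).1 a) h3)

lemma summable_value {p : S → A → S → ℝ} (hp : IsKernel p) {γ : ℝ} (hγ0 : 0 ≤ γ) (hγ1 : γ < 1)
    {π : S → A → ℝ} (hπ : IsPolicy π) {μ : S → ℝ} (hμ : μ ∈ stdSimplex ℝ S) (l : S → A → ℝ) :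
    Summable fun t : ℕ => γ ^ t * ∑ s, ∑ a, stateLaw p π μ t s * π s a * l s a := by
  refine Summable.of_norm_bounded
    (g := fun t : ℕ => γ ^ t * ∑ s, ∑ a, |l s a|)
    ((summable_geometric_of_lt_one hγ0 hγ1).mul_right _)
    fun t => ?_
  rw [norm_mul, Real.norm_eq_abs, Real.norm_eq_abs, abs_of_nonneg (pow_nonneg hγ0 t)]
  exact mul_le_mul_of_nonneg_left (abs_reward_le hp hπ hμ l t) (pow_nonneg hγ0 t)

lemma value_add {p : S → A → S → ℝ} (hp : IsKernel p) {γ : ℝ} (hγ0 : 0 ≤ γ) (hγ1 : γ < 1)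
    {π : S → A → ℝ} (hπ : IsPolicy π) {μ : S → ℝ} (hμ : μ ∈ stdSimplex ℝ S) (l l' : S → A → ℝ) :
    value p γ π (l + l') μ = value p γ π l μ + value p γ π l' μ := by
  unfold value
  rw [← (summable_value hp hγ0 hγ1 hπ hμ l).tsum_add (summable_value hp hγ0 hγ1 hπ hμ l')]
  refine tsum_congr fun t => ?_
  rw [← mul_add, ← Finset.sum_add_distrib]
  simp_rw [← Finset.sum_add_distrib, ← mul_add, Pi.add_apply]

lemma value_smul (p : S → A → S → ℝ) (γ : ℝ) (π : S → A → ℝ) (μ : S → ℝ) (k : ℝ)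
    (l : S → A → ℝ) : value p γ π (k • l) μ = k * value p γ π l μ := by
  unfold value
  rw [← tsum_mul_left]
  refine tsum_congr fun t => ?_
  simp only [Pi.smul_apply, smul_eq_mul, Finset.mul_sum]
  exact Finset.sum_congr rfl fun _ _ => Finset.sum_congr rfl fun _ _ => by ring

lemma continuous_value {p : S → A → S → ℝ} (hp : IsKernel p) {γ : ℝ} (hγ0 : 0 ≤ γ) (hγ1 : γ < 1)
    {π : S → A → ℝ} (hπ : IsPolicy π) {μ : S → ℝ} (hμ : μ ∈ stdSimplex ℝ S) :
    Continuous fun l : S → A → ℝ => value p γ π l μ :=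
  LinearMap.continuous_of_finiteDimensional
    { toFun := fun l : S → A → ℝ => value p γ π l μ
      map_add' := fun l l' => value_add hp hγ0 hγ1 hπ hμ l l'
      map_smul' := fun k l => value_smul p γ π μ k l }

lemma value_eq_sum [DecidableEq S] {p : S → A → S → ℝ} (hp : IsKernel p) {γ : ℝ} (hγ0 : 0 ≤ γ)
    (hγ1 : γ < 1) {π : S → A → ℝ} (hπ : IsPolicy π) (l : S → A → ℝ) (μ : S → ℝ) :
    value p γ π l μ = ∑ s, μ s * value p γ π l (Pi.single s 1) := by
  have hs : ∀ s ∈ (Finset.univ : Finset S), Summable fun t : ℕ => μ s *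
      (γ ^ t * ∑ s', ∑ a, stateLaw p π (Pi.single s 1) t s' * π s' a * l s' a) := fun s _ =>
    (summable_value hp hγ0 hγ1 hπ (single_mem_stdSimplex ℝ s) l).mul_left _
  unfold value
  simp_rw [← tsum_mul_left]
  rw [← Summable.tsum_finsetSum hs]
  refine tsum_congr fun t => ?_
  simp_rw [stateLaw_eq_sum p π μ t, Finset.mul_sum, Finset.sum_mul, Finset.mul_sum]
  have h : ∀ s', ∑ a, ∑ s, γ ^ t * (μ s * stateLaw p π (Pi.single s 1) t s' * π s' a * l s' a) =
      ∑ s, ∑ a, γ ^ t * (μ s * stateLaw p π (Pi.single s 1) t s' * π s' a * l s' a) :=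
    fun s' => Finset.sum_comm
  simp_rw [h]
  rw [Finset.sum_comm]
  exact Finset.sum_congr rfl fun _ _ => Finset.sum_congr rfl fun _ _ =>
    Finset.sum_congr rfl fun _ _ => by ring

/-- The Bellman equation of a policy. -/
lemma value_single [DecidableEq S] {p : S → A → S → ℝ} (hp : IsKernel p) {γ : ℝ} (hγ0 : 0 ≤ γ)
    (hγ1 : γ < 1) {π : S → A → ℝ} (hπ : IsPolicy π) (l : S → A → ℝ) (s : S) :
    value p γ π l (Pi.single s 1) =
      ∑ a, π s a * actionValue p γ l (fun s' => value p γ π l (Pi.single s' 1)) s a := by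
  have h0 : value p γ π l (Pi.single s 1) =
      ∑ a, π s a * l s a + γ * value p γ π l (stateLaw p π (Pi.single s 1) 1) := by
    conv_lhs => unfold value
    rw [(summable_value hp hγ0 hγ1 hπ (single_mem_stdSimplex ℝ s) l).tsum_eq_zero_add]
    congr 1
    · simp [stateLaw, Pi.single_apply]
    · unfold value
      rw [← tsum_mul_left]
      refine tsum_congr fun t => ?_
      rw [stateLaw_succ', pow_succ]
      ring
  have h1 : ∀ s', stateLaw p π (Pi.single s 1) 1 s' = ∑ a, π s a * p s a s' := fun s' => by
    simp [stateLaw, Pi.single_apply]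
  rw [h0, value_eq_sum hp hγ0 hγ1 hπ]
  simp_rw [h1, actionValue, mul_add, Finset.sum_add_distrib, Finset.sum_mul, Finset.mul_sum]
  congr 1
  rw [Finset.sum_comm]
  exact Finset.sum_congr rfl fun _ _ => Finset.sum_congr rfl fun _ _ => by ring

/-- The deterministic policy that plays `m s` at `s`. -/
def detPolicy {S A : Type*} [DecidableEq A] (m : S → A) : S → A → ℝ := fun s => Pi.single (m s) 1

lemma isPolicy_detPolicy {S A : Type*} [Fintype A] [DecidableEq A] (m : S → A) :
    IsPolicy (detPolicy m) :=
  fun s => single_mem_stdSimplex ℝ (m s)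

lemma value_detPolicy_single [DecidableEq S] [DecidableEq A] {p : S → A → S → ℝ}
    (hp : IsKernel p) {γ : ℝ} (hγ0 : 0 ≤ γ) (hγ1 : γ < 1) (m : S → A) (l : S → A → ℝ) (s : S) :
    value p γ (detPolicy m) l (Pi.single s 1) =
      actionValue p γ l (fun s' => value p γ (detPolicy m) l (Pi.single s' 1)) s (m s) := by
  conv_lhs => rw [value_single hp hγ0 hγ1 (isPolicy_detPolicy m)]
  simp [detPolicy, Pi.single_apply]

lemma sum_mul_le_of_le {w : S → ℝ} {q : S → ℝ} (hq : q ∈ stdSimplex ℝ S) {K : ℝ}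
    (h : ∀ s, w s ≤ K) : ∑ s, q s * w s ≤ K := by
  calc ∑ s, q s * w s ≤ ∑ s, q s * K :=
        Finset.sum_le_sum fun s _ => mul_le_mul_of_nonneg_left (h s) (hq.1 s)
    _ = K := by rw [← Finset.sum_mul, hq.2, one_mul]

lemma le_sum_mul_of_le {w : S → ℝ} {q : S → ℝ} (hq : q ∈ stdSimplex ℝ S) {K : ℝ}
    (h : ∀ s, K ≤ w s) : K ≤ ∑ s, q s * w s := by
  calc K = ∑ s, q s * K := by rw [← Finset.sum_mul, hq.2, one_mul]
    _ ≤ ∑ s, q s * w s :=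
        Finset.sum_le_sum fun s _ => mul_le_mul_of_nonneg_left (h s) (hq.1 s)

/-- The comparison principle for discounted recursions. -/
lemma le_of_le_add_discount {γ : ℝ} (hγ0 : 0 ≤ γ) (hγ1 : γ < 1) {K : ℝ} {w : S → ℝ}
    (h : ∀ s, ∃ q ∈ stdSimplex ℝ S, w s ≤ K + γ * ∑ s', q s' * w s') (s : S) :
    w s ≤ K / (1 - γ) := by
  have : Nonempty S := ⟨s⟩
  -- At a maximum `m` of `w` every average of `w` is at most `w m`, so `w m ≤ K + γ * w m`.
  obtain ⟨m, hm⟩ := Finite.exists_max w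
  obtain ⟨q, hq, hw⟩ := h m
  have h1 := sum_mul_le_of_le hq hm
  have h2 : w m ≤ K + γ * w m := hw.trans (by gcongr)
  refine (hm s).trans ?_
  rw [le_div_iff₀ (by linarith)]
  linarith

end

/-! ### Optimal values, greedy policies and the effect of a gap. -/

section

variable {S A : Type*} [Fintype S]

/-- The Bellman optimality equation. -/
def IsOptValue (p : S → A → S → ℝ) (γ : ℝ) (f : S → A → ℝ) (V : S → ℝ) : Prop :=
  ∀ s, (∀ a, actionValue p γ f V s a ≤ V s) ∧ ∃ a, V s = actionValue p γ f V s a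

lemma actionValue_le {p : S → A → S → ℝ} (hp : IsKernel p) {γ : ℝ} (hγ0 : 0 ≤ γ)
    {f f' : S → A → ℝ} {V V' : S → ℝ} {ε κ : ℝ} {s : S} {a : A} (hf : f s a ≤ f' s a + ε)
    (hV : ∀ s, V s ≤ V' s + κ) :
    actionValue p γ f V s a ≤ actionValue p γ f' V' s a + (ε + γ * κ) := by
  have h : ∑ s', p s a s' * (V s' - V' s') ≤ κ :=
    sum_mul_le_of_le (hp s a) fun s' => by linarith [hV s']
  simp_rw [mul_sub, Finset.sum_sub_distrib] at h
  have := mul_le_mul_of_nonneg_left h hγ0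
  unfold actionValue
  linarith

lemma exists_isOptValue [Fintype A] [Nonempty A] {p : S → A → S → ℝ}
    (hp : IsKernel p) {γ : ℝ}
    (hγ0 : 0 ≤ γ) (hγ1 : γ < 1) (f : S → A → ℝ) : ∃ V, IsOptValue p γ f V := by
  let B : (S → ℝ) → S → ℝ := fun V s => Finset.univ.sup' Finset.univ_nonempty
    (actionValue p γ f V s)
  have hB : ∀ V V' : S → ℝ, ∀ s, B V s ≤ B V' s + γ * dist V V' := fun V V' s => by
    refine Finset.sup'_le _ _ fun a _ => ?_
    have h := actionValue_le (f := f) (f' := f) (ε := 0) (s := s) (a := a) (κ := dist V V')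
      hp hγ0 (by simp) (V := V) (V' := V') fun s' => by
        have := (le_abs_self _).trans (dist_le_pi_dist V V' s')
        linarith
    rw [zero_add] at h
    have := Finset.le_sup' (actionValue p γ f V' s) (Finset.mem_univ a)
    exact h.trans (by gcongr)
  have hc : ContractingWith ⟨γ, hγ0⟩ B := by
    refine ⟨by exact_mod_cast hγ1, LipschitzWith.of_dist_le_mul fun V V' => ?_⟩
    refine (dist_pi_le_iff (mul_nonneg hγ0 dist_nonneg)).2 fun s => ?_
    rw [Real.dist_eq, abs_le]
    have h1 := hB V V' s
    have h2 := hB V' V s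
    rw [dist_comm V' V] at h2
    constructor <;> linarith
  have hfix : B (ContractingWith.fixedPoint B hc) = ContractingWith.fixedPoint B hc :=
    hc.fixedPoint_isFixedPt
  refine ⟨ContractingWith.fixedPoint B hc, fun s => ⟨fun a => ?_, ?_⟩⟩
  · conv_rhs => rw [← hfix]
    exact Finset.le_sup' (actionValue p γ f _ s) (Finset.mem_univ a)
  · obtain ⟨a, -, ha⟩ := Finset.exists_mem_eq_sup' Finset.univ_nonempty
      (actionValue p γ f (ContractingWith.fixedPoint B hc) s)
    exact ⟨a, (congrFun hfix s).symm.trans ha⟩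

/-- An action optimal for `V` is at most optimal for `V'`, so `V - V'` satisfies a discounted
inequality along the row of that action. Equal rewards and `ε = 0` give uniqueness of the solution.
-/
lemma IsOptValue.le {p : S → A → S → ℝ} (hp : IsKernel p) {γ : ℝ} (hγ0 : 0 ≤ γ) (hγ1 : γ < 1)
    {f f' : S → A → ℝ} {V V' : S → ℝ} (hV : IsOptValue p γ f V) (hV' : IsOptValue p γ f' V')
    {ε : ℝ} (hf : ∀ s a, f s a ≤ f' s a + ε) (s : S) : V s ≤ V' s + ε / (1 - γ) := by
  have h := le_of_le_add_discount hγ0 hγ1 (K := ε) (w := fun s => V s - V' s) (fun s => ?_) s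
  · linarith
  · obtain ⟨a, ha⟩ := (hV s).2
    refine ⟨p s a, hp s a, ?_⟩
    have h' := (hV' s).1 a
    have h1 := hf s a
    simp_rw [mul_sub, Finset.sum_sub_distrib]
    unfold actionValue at ha h'
    linarith

lemma IsOptValue.le_of_le {p : S → A → S → ℝ} (hp : IsKernel p) {γ : ℝ} (hγ0 : 0 ≤ γ)
    (hγ1 : γ < 1) {f : S → A → ℝ} {V : S → ℝ} (hV : IsOptValue p γ f V) {F : ℝ}
    (hf : ∀ s a, f s a ≤ F) (s : S) : V s ≤ F / (1 - γ) := by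
  refine le_of_le_add_discount hγ0 hγ1 (fun s => ?_) s
  obtain ⟨a, ha⟩ := (hV s).2
  refine ⟨p s a, hp s a, ?_⟩
  have := hf s a
  unfold actionValue at ha
  linarith

lemma IsOptValue.nonneg {p : S → A → S → ℝ} (hp : IsKernel p) {γ : ℝ} (hγ0 : 0 ≤ γ)
    (hγ1 : γ < 1) {f : S → A → ℝ} {V : S → ℝ} (hV : IsOptValue p γ f V)
    (hf : ∀ s a, 0 ≤ f s a) (s : S) : 0 ≤ V s := by
  have h := le_of_le_add_discount hγ0 hγ1 (K := 0) (w := fun s => - V s) (fun s => ?_) s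
  · simp only [zero_div] at h
    linarith
  · obtain ⟨a, -⟩ := (hV s).2
    have ha := (hV s).1 a
    refine ⟨p s a, hp s a, ?_⟩
    have := hf s a
    unfold actionValue at ha
    simp_rw [mul_neg, Finset.sum_neg_distrib]
    linarith

/-- The optimal value function. -/
def optValue (p : S → A → S → ℝ) (γ : ℝ) (f : S → A → ℝ) : S → ℝ :=
  Classical.epsilon (IsOptValue p γ f)

/-- The optimal action value function. -/
def optActionValue (p : S → A → S → ℝ) (γ : ℝ) (f : S → A → ℝ) (s : S) (a : A) : ℝ :=
  actionValue p γ f (optValue p γ f) s a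

lemma isOptValue_optValue [Fintype A] [Nonempty A] {p : S → A → S → ℝ}
    (hp : IsKernel p) {γ : ℝ}
    (hγ0 : 0 ≤ γ) (hγ1 : γ < 1) (f : S → A → ℝ) : IsOptValue p γ f (optValue p γ f) :=
  Classical.epsilon_spec (exists_isOptValue hp hγ0 hγ1 f)

lemma continuous_optValue [Fintype A] [Nonempty A] {p : S → A → S → ℝ}
    (hp : IsKernel p) {γ : ℝ}
    (hγ0 : 0 ≤ γ) (hγ1 : γ < 1) : Continuous (optValue p γ : (S → A → ℝ) → S → ℝ) := by
  have h1 : 0 ≤ 1 / (1 - γ) := by have := sub_pos.2 hγ1; positivity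
  refine LipschitzWith.continuous (K := ⟨1 / (1 - γ), h1⟩)
    (LipschitzWith.of_dist_le_mul fun f f' => ?_)
  refine (dist_pi_le_iff (mul_nonneg h1 dist_nonneg)).2 fun s => ?_
  have key : ∀ f f' : S → A → ℝ, optValue p γ f s ≤ optValue p γ f' s + dist f f' / (1 - γ) :=
    fun f f' => (isOptValue_optValue hp hγ0 hγ1 f).le hp hγ0 hγ1
      (isOptValue_optValue hp hγ0 hγ1 f') (fun s a => by
        have := (le_abs_self _).trans ((dist_le_pi_dist (f s) (f' s) a).trans
          (dist_le_pi_dist f f' s))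
        linarith) s
  have k1 := key f f'
  have k2 := key f' f
  rw [dist_comm f' f] at k2
  rw [Real.dist_eq, abs_le, one_div_mul_eq_div]
  constructor <;> linarith

/-- Continuity in the reward is what makes the gap and greediness measurable in the perturbation. -/
lemma continuous_optActionValue [Fintype A] [Nonempty A] {p : S → A → S → ℝ}
    (hp : IsKernel p) {γ : ℝ}
    (hγ0 : 0 ≤ γ) (hγ1 : γ < 1) (s : S) (a : A) :
    Continuous fun f : S → A → ℝ => optActionValue p γ f s a := by
  have h := continuous_optValue (A := A) hp hγ0 hγ1
  unfold optActionValue actionValue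
  have h' : ∀ s', Continuous fun f : S → A → ℝ => optValue p γ f s' := fun s' =>
    (continuous_apply s').comp h
  fun_prop

/-- `m s` is a greedy action for the optimal action values, at every `s`. -/
def IsGreedy (p : S → A → S → ℝ) (γ : ℝ) (f : S → A → ℝ) (m : S → A) : Prop :=
  ∀ s a, optActionValue p γ f s a ≤ optActionValue p γ f s (m s)

/-- The optimal action values of different actions differ by at least `g`. -/
def HasGap (p : S → A → S → ℝ) (γ : ℝ) (f : S → A → ℝ) (g : ℝ) : Prop :=
  ∀ s a a', a ≠ a' → g ≤ |optActionValue p γ f s a - optActionValue p γ f s a'|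

lemma exists_isGreedy [Fintype A] [Nonempty A] (p : S → A → S → ℝ) (γ : ℝ) (f : S → A → ℝ) :
    ∃ m, IsGreedy p γ f m := by
  have h : ∀ s, ∃ a, ∀ a', optActionValue p γ f s a' ≤ optActionValue p γ f s a := fun s =>
    Finite.exists_max _
  choose m hm using h
  exact ⟨m, hm⟩

/-- A deterministic greedy policy. -/
def greedy [Fintype A] [Nonempty A] (p : S → A → S → ℝ) (γ : ℝ) (f : S → A → ℝ) : S → A :=
  (exists_isGreedy p γ f).choose

lemma isGreedy_greedy [Fintype A] [Nonempty A] (p : S → A → S → ℝ) (γ : ℝ) (f : S → A → ℝ) :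
    IsGreedy p γ f (greedy p γ f) :=
  (exists_isGreedy p γ f).choose_spec

lemma IsGreedy.optActionValue_eq [Fintype A] [Nonempty A] {p : S → A → S → ℝ}
    (hp : IsKernel p) {γ : ℝ}
    (hγ0 : 0 ≤ γ) (hγ1 : γ < 1) {f : S → A → ℝ} {m : S → A} (hm : IsGreedy p γ f m) (s : S) :
    optActionValue p γ f s (m s) = optValue p γ f s := by
  obtain ⟨h1, a, ha⟩ := isOptValue_optValue hp hγ0 hγ1 f s
  exact le_antisymm (h1 _) (ha.le.trans (hm s a))

lemma IsGreedy.add_gap_le {p : S → A → S → ℝ} {γ : ℝ} {f : S → A → ℝ} {m : S → A} {g : ℝ}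
    (hm : IsGreedy p γ f m) (hg : HasGap p γ f g) {s : S} {a : A} (ha : a ≠ m s) :
    optActionValue p γ f s a + g ≤ optActionValue p γ f s (m s) := by
  have h1 := hg s a (m s) ha
  rw [abs_sub_comm, abs_of_nonneg (sub_nonneg.2 (hm s a))] at h1
  linarith

/-- If `K` is the largest excess of the policy's value over the optimal one, a Bellman step gives `K
≤ γ * K`. -/
lemma value_le_optValue [Fintype A] [Nonempty A] [DecidableEq S] {p : S → A → S → ℝ}
    (hp : IsKernel p) {γ : ℝ} (hγ0 : 0 ≤ γ) (hγ1 : γ < 1) {π : S → A → ℝ} (hπ : IsPolicy π)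
    (f : S → A → ℝ)
    (s : S) : value p γ π f (Pi.single s 1) ≤ optValue p γ f s := by
  have hV := isOptValue_optValue hp hγ0 hγ1 f
  set v : S → ℝ := fun s => value p γ π f (Pi.single s 1) with hv
  obtain ⟨K, hK⟩ : ∃ K, K = Finset.univ.sup' ⟨s, Finset.mem_univ s⟩
    (fun s => v s - optValue p γ f s) := ⟨_, rfl⟩
  have hK' : ∀ s', v s' ≤ optValue p γ f s' + K := fun s' => by
    have := Finset.le_sup' (fun s => v s - optValue p γ f s) (Finset.mem_univ s')
    rw [← hK] at this
    linarith
  have h2 : ∀ s', v s' ≤ optValue p γ f s' + γ * K := fun s' => by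
    rw [hv]
    simp only
    rw [value_single hp hγ0 hγ1 hπ]
    refine sum_mul_le_of_le (hπ s') fun a => ?_
    have h3 := actionValue_le (f := f) (f' := f) (ε := 0) (s := s') (a := a) hp hγ0 (by simp) hK'
    have h4 := (hV s').1 a
    linarith
  have h5 : K ≤ γ * K := by
    conv_lhs => rw [hK]
    exact Finset.sup'_le _ _ fun s' _ => by linarith [h2 s']
  have h6 : K ≤ 0 := by nlinarith
  linarith [hK' s]

lemma IsGreedy.value_eq [Fintype A] [Nonempty A] [DecidableEq S] [DecidableEq A]
    {p : S → A → S → ℝ} (hp : IsKernel p) {γ : ℝ} (hγ0 : 0 ≤ γ) (hγ1 : γ < 1) {f : S → A → ℝ}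
    {m : S → A} (hm : IsGreedy p γ f m) (s : S) :
    value p γ (detPolicy m) f (Pi.single s 1) = optValue p γ f s := by
  refine le_antisymm (value_le_optValue hp hγ0 hγ1 (isPolicy_detPolicy m) f s) ?_
  have h := le_of_le_add_discount hγ0 hγ1 (K := 0) (w := fun s => optValue p γ f s -
    value p γ (detPolicy m) f (Pi.single s 1)) (fun s => ?_) s
  · simp only [zero_div] at h
    linarith
  · refine ⟨p s (m s), hp s (m s), ?_⟩
    rw [value_detPolicy_single hp hγ0 hγ1, ← hm.optActionValue_eq hp hγ0 hγ1]
    simp_rw [mul_sub, Finset.sum_sub_distrib]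
    unfold optActionValue actionValue
    linarith

/-- Under a gap, the greedy deterministic policy is the only optimal policy. -/
lemma IsOptimalPolicy.eq_detPolicy [Fintype A] [Nonempty A] [DecidableEq S] [DecidableEq A]
    {p : S → A → S → ℝ} (hp : IsKernel p) {γ : ℝ} (hγ0 : 0 ≤ γ) (hγ1 : γ < 1)
    {f π : S → A → ℝ} {m : S → A} (hπ : IsOptimalPolicy p γ f π) (hm : IsGreedy p γ f m) {g : ℝ}
    (hg0 : 0 < g) (hg : HasGap p γ f g) : π = detPolicy m := by
  have hval : (fun s => value p γ π f (Pi.single s 1)) = optValue p γ f := funext fun s =>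
    le_antisymm (value_le_optValue hp hγ0 hγ1 hπ.1 f s)
      ((hm.value_eq hp hγ0 hγ1 s).ge.trans (hπ.2 _ (isPolicy_detPolicy m) s))
  have hzero : ∀ s a, a ≠ m s → π s a = 0 := by
    intro s a ha
    have h1 := value_single hp hγ0 hγ1 hπ.1 f s
    rw [hval, congrFun hval s] at h1
    -- The average under `π` of the nonnegative losses `V - Q` is zero, while the gap makes the loss
    -- of each non-greedy action positive.
    have h2 : ∑ a, π s a * (optValue p γ f s - optActionValue p γ f s a) = 0 := by
      simp_rw [mul_sub, Finset.sum_sub_distrib]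
      rw [← Finset.sum_mul, (hπ.1 s).2, one_mul, sub_eq_zero]
      exact h1
    have h3 := (Finset.sum_eq_zero_iff_of_nonneg fun a _ => mul_nonneg ((hπ.1 s).1 a)
      (sub_nonneg.2 ((isOptValue_optValue hp hγ0 hγ1 f s).1 a))).1 h2 a (Finset.mem_univ a)
    have h4 := hm.add_gap_le hg ha
    rw [hm.optActionValue_eq hp hγ0 hγ1] at h4
    refine (mul_eq_zero.1 h3).resolve_right (ne_of_gt ?_)
    unfold optActionValue at h4
    linarith
  ext s a
  by_cases ha : a = m s
  · subst ha
    have h := (hπ.1 s).2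
    rw [Finset.sum_eq_single (m s) (fun b _ hb => hzero s b hb) (by simp)] at h
    simp [detPolicy, h]
  · simp [detPolicy, ha, hzero s a ha]

/-- The difference of two optimal action values at `s` expands in the reward at `(s, a)`. -/
lemma IsOptValue.expand {p : S → A → S → ℝ} (hp : IsKernel p) {γ : ℝ} (hγ0 : 0 ≤ γ)
    (hγ1 : γ < 1) {f f' : S → A → ℝ} {V V' : S → ℝ} (hV : IsOptValue p γ f V)
    (hV' : IsOptValue p γ f' V') {s : S} {a a' : A} (haa : a ≠ a')
    (hff : ∀ s' b, (s', b) ≠ (s, a) → f' s' b = f s' b) {Δ : ℝ} (hΔ : 0 ≤ Δ)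
    (hfs : f' s a = f s a + Δ) :
    (1 - γ) * Δ ≤ (actionValue p γ f' V' s a - actionValue p γ f' V' s a') -
      (actionValue p γ f V s a - actionValue p γ f V s a') := by
  have hmono : ∀ s, V s ≤ V' s := fun s' => by
    have := hV.le hp hγ0 hγ1 hV' (ε := 0) (fun s' b => ?_) s'
    · simpa using this
    · by_cases h : (s', b) = (s, a)
      · cases h
        linarith
      · simp [hff s' b h]
  have : Nonempty S := ⟨s⟩
  obtain ⟨t, ht⟩ := Finite.exists_max fun s => V' s - V s
  set m := V' t - V t with hm
  have hm0 : 0 ≤ m := sub_nonneg.2 (hmono t)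
  have hup : ∀ s' b, ∑ x, p s' b x * (V' x - V x) ≤ m := fun s' b => sum_mul_le_of_le (hp s' b) ht
  have hdn : ∀ s' b, 0 ≤ ∑ x, p s' b x * (V' x - V x) := fun s' b =>
    le_sum_mul_of_le (hp s' b) fun x => sub_nonneg.2 (hmono x)
  have hdiff : ∀ s' b, actionValue p γ f' V' s' b - actionValue p γ f V s' b =
      f' s' b - f s' b + γ * ∑ x, p s' b x * (V' x - V x) := fun s' b => by
    simp_rw [actionValue, mul_sub, Finset.sum_sub_distrib]
    ring
  have hX1 : Δ ≤ actionValue p γ f' V' s a - actionValue p γ f V s a := by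
    rw [hdiff, hfs]
    linarith [mul_nonneg hγ0 (hdn s a)]
  -- The maximal increase `m` of the value is attained through some action. If that is not `(s, a)`,
  -- then its reward is unchanged and `m ≤ γ * m`, so `m ≤ 0`.
  have hX2 : m ≤ actionValue p γ f' V' s a - actionValue p γ f V s a := by
    obtain ⟨b, hb⟩ := (hV' t).2
    have h1 := (hV t).1 b
    have h2 : m ≤ actionValue p γ f' V' t b - actionValue p γ f V t b := by rw [hm]; linarith
    by_cases h : (t, b) = (s, a)
    · cases h
      exact h2
    · rw [hdiff, hff t b h, sub_self, zero_add] at h2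
      have := mul_le_mul_of_nonneg_left (hup t b) hγ0
      nlinarith
  have hY : actionValue p γ f' V' s a' - actionValue p γ f V s a' ≤ γ * m := by
    rw [hdiff, hff s a' (by simpa using haa.symm), sub_self, zero_add]
    exact mul_le_mul_of_nonneg_left (hup s a') hγ0
  -- With `X` the increase at `a` and `Y` that at `a'`: `X - Y ≥ X - γ m ≥ (1 - γ) X ≥ (1 - γ) Δ`.
  have h1 := mul_le_mul_of_nonneg_left hX2 hγ0
  have h2 := mul_le_mul_of_nonneg_left hX1 (sub_nonneg.2 hγ1.le)
  linarith

end

/-! ### Absorbing models that forget one row. -/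

section

variable {S A : Type*} [Fintype S]

/-- The transition matrix in which `(s₀, a₀)` leads back to `s₀`. -/
def absorb [DecidableEq S] [DecidableEq A] (p : S → A → S → ℝ) (s₀ : S) (a₀ : A) :
    S → A → S → ℝ :=
  Function.update p s₀ (Function.update (p s₀) a₀ (Pi.single s₀ 1))

/-- The reward `f`, with the value `u` at `(s₀, a₀)`. -/
def setReward [DecidableEq S] [DecidableEq A] (f : S → A → ℝ) (s₀ : S) (a₀ : A) (u : ℝ) :
    S → A → ℝ :=
  Function.update f s₀ (Function.update (f s₀) a₀ u)

lemma update_update_apply {S A : Type*} [DecidableEq S] [DecidableEq A] {β : Type*}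
    (f : S → A → β) (s₀ : S) (a₀ : A) (u : β) (s : S) (a : A) :
    Function.update f s₀ (Function.update (f s₀) a₀ u) s a =
      if s = s₀ ∧ a = a₀ then u else f s a := by
  by_cases h : s = s₀
  · subst h
    by_cases h' : a = a₀ <;> simp [h']
  · simp [h]

lemma isKernel_absorb [DecidableEq S] [DecidableEq A] {p : S → A → S → ℝ} (hp : IsKernel p)
    (s₀ : S) (a₀ : A) : IsKernel (absorb p s₀ a₀) := by
  intro s a
  rw [absorb, update_update_apply]
  split_ifs
  · exact single_mem_stdSimplex ℝ s₀
  · exact hp s a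

/-- The reward for which the absorbing model has the same optimal values as the original one. -/
def absorbReward [DecidableEq S] (p : S → A → S → ℝ) (γ : ℝ) (f : S → A → ℝ) (s₀ : S) (a₀ : A) :
    ℝ :=
  optActionValue p γ f s₀ a₀ - γ * optValue p γ f s₀

/-- Under a gap, the greedy policy is the greedy policy of the absorbing model with a rounded
reward. -/
lemma IsGreedy.eq_of_absorb [Fintype A] [Nonempty A] [DecidableEq S] [DecidableEq A]
    {p : S → A → S → ℝ} (hp : IsKernel p) {γ : ℝ} (hγ0 : 0 ≤ γ) (hγ1 : γ < 1) {f : S → A → ℝ}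
    {m m' : S → A} (hm : IsGreedy p γ f m) {g h u : ℝ} (hg : HasGap p γ f g)
    (hgh : 2 * h / (1 - γ) < g) {s₀ : S} {a₀ : A}
    (hu : |u - absorbReward p γ f s₀ a₀| ≤ h)
    (hm' : IsGreedy (absorb p s₀ a₀) γ (setReward f s₀ a₀ u) m') : m' = m := by
  have hp' := isKernel_absorb hp s₀ a₀
  set V := optValue p γ f with hVdef
  set p' := absorb p s₀ a₀ with hp'def
  set f' := setReward f s₀ a₀ (absorbReward p γ f s₀ a₀) with hf'
  -- At `(s₀, a₀)` the self-loop contributes `γ * V s₀`, exactly what `absorbReward` subtracts, so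
  -- `V` solves the Bellman equation of both models.
  have hQ : ∀ s a, actionValue p' γ f' V s a = optActionValue p γ f s a := by
    intro s a
    rw [actionValue, hp'def, hf', absorb, setReward, update_update_apply, update_update_apply]
    split_ifs with hsa
    · rcases hsa with ⟨rfl, rfl⟩
      simp [absorbReward, Pi.single_apply, hVdef]
    · rfl
  have hV : IsOptValue p' γ f' V := by
    intro s
    simp_rw [hQ]
    exact isOptValue_optValue hp hγ0 hγ1 f s
  have hV' := isOptValue_optValue hp' hγ0 hγ1 (setReward f s₀ a₀ u)
  have hle : ∀ s a, |setReward f s₀ a₀ u s a - f' s a| ≤ h := by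
    intro s a
    rw [hf', setReward, setReward, update_update_apply, update_update_apply]
    split_ifs
    · exact hu
    · simpa using (abs_nonneg _).trans hu
  have h1 : ∀ s, V s ≤ optValue p' γ (setReward f s₀ a₀ u) s + h / (1 - γ) :=
    hV.le hp' hγ0 hγ1 hV' fun s a => by linarith [(abs_le.1 (hle s a)).1]
  have h2 : ∀ s, optValue p' γ (setReward f s₀ a₀ u) s ≤ V s + h / (1 - γ) :=
    hV'.le hp' hγ0 hγ1 hV fun s a => by linarith [(abs_le.1 (hle s a)).2]
  -- Rounding moves each action value by at most `h / (1 - γ)`, so comparing two actions costs at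
  -- most `2 * h / (1 - γ) < g`.
  have hγ : h + γ * (h / (1 - γ)) = h / (1 - γ) := by
    have : (1 - γ) ≠ 0 := by linarith
    field_simp
    ring
  funext s
  by_contra hne
  have h3 := hm.add_gap_le hg hne
  have h4 := hm' s (m s)
  have h5 := actionValue_le (s := s) (a := m s) (f := f') (f' := setReward f s₀ a₀ u) (ε := h)
    hp' hγ0 (by linarith [(abs_le.1 (hle s (m s))).1]) h1
  have h6 := actionValue_le (s := s) (a := m' s) (f := setReward f s₀ a₀ u) (f' := f') (ε := h)
    hp' hγ0 (by linarith [(abs_le.1 (hle s (m' s))).2]) h2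
  rw [hQ, hγ] at h5 h6
  unfold optActionValue at h4 h5 h6 h3
  have h7 : 2 * h / (1 - γ) = h / (1 - γ) + h / (1 - γ) := by ring
  linarith

/-- A difference of two numbers in `[0, F / (1 - γ)]`. This is the range that the grid of rewards
has to cover. -/
lemma abs_absorbReward_le [Fintype A] [Nonempty A] [DecidableEq S]
    {p : S → A → S → ℝ} (hp : IsKernel p) {γ : ℝ} (hγ0 : 0 ≤ γ) (hγ1 : γ < 1) {f : S → A → ℝ}
    {F : ℝ} (hf0 : ∀ s a, 0 ≤ f s a) (hf : ∀ s a, f s a ≤ F) (s₀ : S) (a₀ : A) :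
    |absorbReward p γ f s₀ a₀| ≤ F / (1 - γ) := by
  have hV := isOptValue_optValue hp hγ0 hγ1 f
  have h1 := hV.le_of_le hp hγ0 hγ1 hf
  have h0 := hV.nonneg hp hγ0 hγ1 hf0
  have h2 : 0 ≤ optActionValue p γ f s₀ a₀ := by
    have := mul_nonneg hγ0 (le_sum_mul_of_le (hp s₀ a₀) h0)
    have := hf0 s₀ a₀
    unfold optActionValue actionValue
    linarith
  have h3 : optActionValue p γ f s₀ a₀ ≤ F / (1 - γ) := ((hV s₀).1 a₀).trans (h1 s₀)
  have h4 := mul_nonneg hγ0 (h0 s₀)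
  have h5 : γ * optValue p γ f s₀ ≤ F / (1 - γ) :=
    (mul_le_of_le_one_left (h0 s₀) hγ1.le).trans (h1 s₀)
  rw [absorbReward, abs_le]
  constructor <;> linarith

/-! ### Variances and the sharp dependence on the horizon. -/

/-- The variance of `g` under `q`. -/
def variance (q : S → ℝ) (g : S → ℝ) : ℝ :=
  ∑ s, q s * g s ^ 2 - (∑ s, q s * g s) ^ 2

lemma variance_eq {q : S → ℝ} (hq : q ∈ stdSimplex ℝ S) (g : S → ℝ) (k : ℝ) :
    variance q g + (∑ s, q s * g s - k) ^ 2 = ∑ s, q s * (g s - k) ^ 2 := by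
  have h : ∀ s, q s * (g s - k) ^ 2 = q s * g s ^ 2 - 2 * k * (q s * g s) + q s * k ^ 2 :=
    fun s => by ring
  simp_rw [h, Finset.sum_add_distrib, Finset.sum_sub_distrib, ← Finset.mul_sum, ← Finset.sum_mul,
    hq.2, variance]
  ring

lemma variance_nonneg {q : S → ℝ} (hq : q ∈ stdSimplex ℝ S) (g : S → ℝ) : 0 ≤ variance q g := by
  have h := variance_eq hq g (∑ s, q s * g s)
  rw [sub_self] at h
  have h1 : 0 ≤ ∑ s, q s * (g s - ∑ s, q s * g s) ^ 2 :=
    Finset.sum_nonneg fun s _ => mul_nonneg (hq.1 s) (sq_nonneg _)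
  linarith

/-- The variance of `g ^ 2` is at most its second moment about `e ^ 2`, where `e` is the mean of
`g`, and `|g ^ 2 - e ^ 2| ≤ 2 b |g - e|`. -/
lemma variance_sq_le {q : S → ℝ} (hq : q ∈ stdSimplex ℝ S) {g : S → ℝ} {b : ℝ}
    (hg0 : ∀ s, 0 ≤ g s) (hg : ∀ s, g s ≤ b) :
    variance q (fun s => g s ^ 2) ≤ 4 * b ^ 2 * variance q g := by
  set e := ∑ s, q s * g s with he
  have he0 : 0 ≤ e := le_sum_mul_of_le hq hg0
  have he1 : e ≤ b := sum_mul_le_of_le hq hg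
  have h1 := variance_eq hq (fun s => g s ^ 2) (e ^ 2)
  have h2 := variance_eq hq g e
  rw [← he, sub_self] at h2
  have h3 : ∑ s, q s * (g s ^ 2 - e ^ 2) ^ 2 ≤ 4 * b ^ 2 * ∑ s, q s * (g s - e) ^ 2 := by
    rw [Finset.mul_sum]
    refine Finset.sum_le_sum fun s _ => ?_
    have h4 : (g s + e) ^ 2 ≤ 4 * b ^ 2 := by nlinarith [hg0 s, hg s]
    have h5 := mul_le_mul_of_nonneg_left h4 (mul_nonneg (hq.1 s) (sq_nonneg (g s - e)))
    linarith
  nlinarith [sq_nonneg (∑ s, q s * g s ^ 2 - e ^ 2)]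

/-- The empirical next state law `q` is close to `p` for the value function `v`. -/
structure RowGood (γ b η : ℝ) (p q v : S → ℝ) : Prop where
  upper : γ * (∑ s, q s * v s - ∑ s, p s * v s) ≤ η / (2 * b) * (γ ^ 2 * variance p v) + 2 * η
  lower : γ * (∑ s, p s * v s - ∑ s, q s * v s) ≤ η / (2 * b) * (γ ^ 2 * variance p v) + 2 * η
  sq : γ * (∑ s, p s * v s ^ 2 - ∑ s, q s * v s ^ 2) ≤
    1 / 4 * (γ ^ 2 * variance p v) + 16 * b * η ^ 2

/-- Closeness of the rows of two transition matrices under a policy bounds the difference of the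
values with the optimal dependence on the horizon. -/
lemma abs_sub_le_of_rowGood {γ : ℝ} (hγ0 : 0 ≤ γ) (hγ1 : γ < 1) {b η : ℝ} (hb : b = 1 / (1 - γ))
    (hη0 : 0 ≤ η) (hη : η ^ 2 ≤ 1 / 72) {p q : S → S → ℝ} (hp : ∀ s, p s ∈ stdSimplex ℝ S)
    (hq : ∀ s, q s ∈ stdSimplex ℝ S) {l v w : S → ℝ} (hl0 : ∀ s, 0 ≤ l s) (hl1 : ∀ s, l s ≤ 1)
    (hv : ∀ s, v s = l s + γ * ∑ s', p s s' * v s')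
    (hw : ∀ s, w s = l s + γ * ∑ s', q s s' * w s')
    (hrow : ∀ s, RowGood γ b η (p s) (q s) v) (s : S) : |v s - w s| ≤ 7 / 2 * b * η := by
  have hγ' : 0 < 1 - γ := sub_pos.2 hγ1
  have hb0 : 0 < b := by rw [hb]; positivity
  have hv0 : ∀ s, 0 ≤ v s := fun s => by
    have := le_of_le_add_discount hγ0 hγ1 (K := 0) (w := fun s => - v s) (fun s =>
      ⟨p s, hp s, by simp_rw [mul_neg, Finset.sum_neg_distrib]; linarith [hv s, hl0 s]⟩) s
    rw [zero_div] at this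
    linarith
  have hv1 : ∀ s, v s ≤ b := fun s => by
    rw [hb]
    exact le_of_le_add_discount hγ0 hγ1 (fun s => ⟨p s, hp s, by linarith [hv s, hl1 s]⟩) s
  -- By the Bellman equation, `γ * ∑ p v = v - l`. The field `sq` then trades `p` for `q` at the
  -- cost of a quarter of the variance, whence the factor `4 / 3`; the remainder is `4 / 3 * (2 + 16
  -- / 72) * b ≤ 3 * b`.
  have hvar : ∀ s, γ ^ 2 * variance (p s) v ≤
      4 / 3 * (γ * ∑ s', q s s' * v s' ^ 2 - v s ^ 2) + 3 * b := by
    intro s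
    have h1 : γ ^ 2 * variance (p s) v =
        γ ^ 2 * ∑ s', p s s' * v s' ^ 2 - (v s - l s) ^ 2 := by
      have : v s - l s = γ * ∑ s', p s s' * v s' := by linarith [hv s]
      rw [this, variance]
      ring
    have h2 : 0 ≤ ∑ s', p s s' * v s' ^ 2 := le_sum_mul_of_le (hp s) fun s' => sq_nonneg _
    have h3 : γ ^ 2 * ∑ s', p s s' * v s' ^ 2 ≤ γ * ∑ s', p s s' * v s' ^ 2 :=
      mul_le_mul_of_nonneg_right (by nlinarith) h2
    have h4 := (hrow s).sq
    have h5 : l s * v s ≤ b := (mul_le_of_le_one_left (hv0 s) (hl1 s)).trans (hv1 s)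
    have h6 : b * η ^ 2 ≤ b * (1 / 72) := mul_le_mul_of_nonneg_left hη hb0.le
    nlinarith [sq_nonneg (l s)]
  have key : ∀ σ : ℝ, (σ = 1 ∨ σ = -1) → ∀ s, σ * (w s - v s) ≤ 7 / 2 * b * η := by
    intro σ hσ s
    -- By `hvar`, the variance is bounded by a discounted increment of `v ^ 2` under `q`, which the
    -- added square cancels. The constants left are `2 * η` from the row bound and `3 / 2 * η` from
    -- `3 * b`.
    have h := le_of_le_add_discount hγ0 hγ1 (K := 7 / 2 * η)
      (w := fun s => σ * (w s - v s) + η / (2 * b) * (4 / 3) * v s ^ 2) (fun s => ⟨q s, hq s, ?_⟩) s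
    · have h1 : 0 ≤ η / (2 * b) * (4 / 3) * v s ^ 2 := by positivity
      have h2 : 7 / 2 * η / (1 - γ) = 7 / 2 * b * η := by rw [hb]; ring
      linarith
    · have h1 : ∑ s', q s s' * (σ * (w s' - v s') + η / (2 * b) * (4 / 3) * v s' ^ 2) =
          σ * (∑ s', q s s' * w s' - ∑ s', q s s' * v s') +
            η / (2 * b) * (4 / 3) * ∑ s', q s s' * v s' ^ 2 := by
        rw [← Finset.sum_sub_distrib, Finset.mul_sum, Finset.mul_sum, ← Finset.sum_add_distrib]
        exact Finset.sum_congr rfl fun _ _ => by ring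
      have h2 : γ * (σ * (∑ s', q s s' * v s' - ∑ s', p s s' * v s')) ≤
          η / (2 * b) * (γ ^ 2 * variance (p s) v) + 2 * η := by
        rcases hσ with rfl | rfl
        · linarith [(hrow s).upper]
        · linarith [(hrow s).lower]
      have h3 := mul_le_mul_of_nonneg_left (hvar s) (show 0 ≤ η / (2 * b) by positivity)
      have h4 : η / (2 * b) * (3 * b) = 3 / 2 * η := by field_simp
      have h5 : σ * (w s - v s) = γ * (σ * (∑ s', q s s' * w s' - ∑ s', q s s' * v s')) +
          γ * (σ * (∑ s', q s s' * v s' - ∑ s', p s s' * v s')) := by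
        rw [hw s, hv s]
        ring
      rw [h1, h5]
      rw [mul_add] at h3
      linarith
  rw [abs_le]
  constructor
  · linarith [key 1 (Or.inl rfl) s]
  · linarith [key (-1) (Or.inr rfl) s]

end

/-! ### Product measures and Bernstein's inequality for one row. -/

section

/-- A set has small product measure if all its sections in one coordinate have small measure. -/
lemma pi_le_of_forall_update {ι : Type*} [Fintype ι] [DecidableEq ι] {X : ι → Type*}
    [∀ i, MeasurableSpace (X i)] (μ : ∀ i, Measure (X i)) [∀ i, IsProbabilityMeasure (μ i)]
    {B : Set (∀ i, X i)} (hB : MeasurableSet B) (i : ι) {k : ENNReal}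
    (h : ∀ x, μ i {y | Function.update x i y ∈ B} ≤ k) : Measure.pi μ B ≤ k := by
  have h1 : ∫⁻ x, B.indicator 1 x ∂Measure.pi μ ≤ ∫⁻ _, k ∂Measure.pi μ := by
    refine lintegral_le_of_lmarginal_le {i} (measurable_one.indicator hB) measurable_const ?_
    rw [lmarginal_singleton, lmarginal_singleton]
    intro x
    simp only [lintegral_const, measure_univ, mul_one]
    refine le_trans (le_of_eq ?_) (h x)
    exact lintegral_indicator_one (μ := μ i) (hB.preimage (measurable_update x))
  rwa [lintegral_indicator_one hB, lintegral_const, measure_univ, mul_one] at h1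

/-- Allows freezing all samples, or all perturbations, except those at `(s, a)`. -/
lemma pi_pi_le_of_forall_update {S A : Type*} [Fintype S] [DecidableEq S] [Fintype A]
    [DecidableEq A] {X : Type*} [MeasurableSpace X] (μ : S → A → Measure X)
    [∀ s a, IsProbabilityMeasure (μ s a)] {B : Set (S → A → X)} (hB : MeasurableSet B)
    (s : S) (a : A) {k : ENNReal}
    (h : ∀ x, μ s a {y | Function.update x s (Function.update (x s) a y) ∈ B} ≤ k) :
    (Measure.pi fun s => Measure.pi (μ s)) B ≤ k := by
  refine pi_le_of_forall_update _ hB s fun x => ?_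
  refine pi_le_of_forall_update (μ s) (hB.preimage (measurable_update x)) a fun x' => ?_
  have := h (Function.update x s x')
  simpa using this

variable {S : Type*} [Fintype S]

/-- The empirical law of a sample. -/
def empRow [DecidableEq S] {N : ℕ} (y : Fin N → S) : S → ℝ :=
  fun s' => ((Finset.univ.filter fun j : Fin N => y j = s').card : ℝ) / N

lemma sum_empRow_mul [DecidableEq S] {N : ℕ} (y : Fin N → S) (g : S → ℝ) :
    ∑ s, empRow y s * g s = (∑ j, g (y j)) / N := by
  simp_rw [empRow, div_mul_eq_mul_div, ← Finset.sum_div]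
  congr 1
  simp_rw [← nsmul_eq_mul]
  exact (Finset.sum_comp g y).symm ▸ (Finset.sum_subset (Finset.subset_univ _) fun s _ hs => by
    have : Finset.univ.filter (fun j : Fin N => y j = s) = ∅ := by
      refine Finset.filter_eq_empty_iff.2 fun j _ hj => hs ?_
      exact Finset.mem_image.2 ⟨j, Finset.mem_univ _, hj⟩
    simp [this]).symm

lemma empRow_mem [DecidableEq S] {N : ℕ} (hN : 0 < N) (y : Fin N → S) :
    empRow y ∈ stdSimplex ℝ S := by
  refine ⟨fun s => by unfold empRow; positivity, ?_⟩
  have h := sum_empRow_mul y fun _ => 1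
  have : (N : ℝ) ≠ 0 := by positivity
  simpa [this] using h

lemma toReal_mem_stdSimplex (P : PMF S) : (fun s => (P s).toReal) ∈ stdSimplex ℝ S := by
  refine ⟨fun s => ENNReal.toReal_nonneg, ?_⟩
  rw [← ENNReal.toReal_sum fun s _ => P.apply_ne_top s, ← tsum_fintype (L := .unconditional _),
    P.tsum_coe]
  rfl

lemma abs_sub_le_of_mem {q : S → ℝ} (hq : q ∈ stdSimplex ℝ S) {g : S → ℝ} {b : ℝ}
    (hg0 : ∀ s, 0 ≤ g s) (hg : ∀ s, g s ≤ b) (s : S) : |g s - ∑ s, q s * g s| ≤ b := by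
  have h0 := le_sum_mul_of_le hq hg0
  have h1 := sum_mul_le_of_le hq hg
  rw [abs_le]
  constructor <;> linarith [hg0 s, hg s]

lemma variance_neg (q g : S → ℝ) : variance q (fun s => - g s) = variance q g := by
  simp [variance, Finset.sum_neg_distrib]

variable [DecidableEq S] [MeasurableSpace S] [MeasurableSingletonClass S]

/-- Bernstein's inequality for an empirical mean, before optimizing over `θ`. -/
lemma measure_mean_sub_le (P : PMF S) {N : ℕ} (hN : 0 < N) (g : S → ℝ) {θ ℓ : ℝ} (hθ : 0 < θ)
    (hg : ∀ s, |θ * (g s - ∑ s, (P s).toReal * g s)| ≤ 1) :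
    (Measure.pi fun _ : Fin N => P.toMeasure)
      {y | θ * variance (fun s => (P s).toReal) g + ℓ / (N * θ) <
        ∑ s, empRow y s * g s - ∑ s, (P s).toReal * g s} ≤ ENNReal.ofReal (Real.exp (-ℓ)) := by
  have hP := toReal_mem_stdSimplex P
  set p : S → ℝ := fun s => (P s).toReal with hp
  set e := ∑ s, p s * g s with he
  have hN' : (0 : ℝ) < N := by exact_mod_cast hN
  set X : (Fin N → S) → ℝ := fun y => ∑ j, (g (y j) - e) with hX
  have hmgf1 : ∫ s, Real.exp (θ * (g s - e)) ∂P.toMeasure ≤ Real.exp (θ ^ 2 * variance p g) := by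
    rw [PMF.integral_eq_sum]
    -- `exp x ≤ 1 + x + x ^ 2` for `|x| ≤ 1`; the linear term has mean zero, and the quadratic one
    -- gives the variance.
    have h1 : ∀ s, Real.exp (θ * (g s - e)) ≤ 1 + θ * (g s - e) + (θ * (g s - e)) ^ 2 := fun s => by
      linarith [(abs_le.1 (Real.abs_exp_sub_one_sub_id_le (hg s))).2]
    have h2 := variance_eq hP g e
    rw [← he, sub_self] at h2
    calc ∑ s, p s • Real.exp (θ * (g s - e))
        ≤ ∑ s, p s * (1 + θ * (g s - e) + (θ * (g s - e)) ^ 2) :=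
          Finset.sum_le_sum fun s _ => mul_le_mul_of_nonneg_left (h1 s) (hP.1 s)
      _ = ∑ s, p s + θ * (∑ s, p s * g s - (∑ s, p s) * e) +
          θ ^ 2 * ∑ s, p s * (g s - e) ^ 2 := by
          rw [Finset.sum_mul, ← Finset.sum_sub_distrib, Finset.mul_sum, Finset.mul_sum,
            ← Finset.sum_add_distrib, ← Finset.sum_add_distrib]
          exact Finset.sum_congr rfl fun s _ => by ring
      _ = θ ^ 2 * variance p g + 1 := by rw [← h2, hP.2, ← he]; ring
      _ ≤ Real.exp (θ ^ 2 * variance p g) := Real.add_one_le_exp _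
  have hmgf : ProbabilityTheory.mgf X (Measure.pi fun _ : Fin N => P.toMeasure) θ ≤
      Real.exp (N * (θ ^ 2 * variance p g)) := by
    have h1 : ∀ y, Real.exp (θ * X y) = ∏ j, Real.exp (θ * (g (y j) - e)) := fun y => by
      rw [hX, Finset.mul_sum, Real.exp_sum]
    simp_rw [ProbabilityTheory.mgf, h1]
    rw [integral_fintype_prod_eq_prod (fun _ : Fin N => fun s => Real.exp (θ * (g s - e))),
      Finset.prod_const, Finset.card_univ, Fintype.card_fin, Real.exp_nat_mul]
    exact pow_le_pow_left₀ (integral_nonneg fun s => (Real.exp_pos _).le) hmgf1 N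
  have hch := ProbabilityTheory.measure_ge_le_exp_mul_mgf (X := X)
    (μ := Measure.pi fun _ : Fin N => P.toMeasure) (N * (θ * variance p g + ℓ / (N * θ))) hθ.le
    (Integrable.of_finite)
  have hsub : {y : Fin N → S | θ * variance p g + ℓ / (N * θ) < ∑ s, empRow y s * g s - e} ⊆
      {y | N * (θ * variance p g + ℓ / (N * θ)) ≤ X y} := fun y hy => by
    have hy' : θ * variance p g + ℓ / (N * θ) < ∑ s, empRow y s * g s - e := hy
    have h1 : X y = N * (∑ s, empRow y s * g s - e) := by
      simp only [hX]
      rw [sum_empRow_mul, Finset.sum_sub_distrib]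
      field_simp
      simp
    show _ ≤ X y
    rw [h1]
    exact mul_le_mul_of_nonneg_left hy'.le hN'.le
  refine (measure_mono hsub).trans ?_
  rw [← ofReal_measureReal]
  refine ENNReal.ofReal_le_ofReal (hch.trans ?_)
  calc _ ≤ Real.exp (-θ * (N * (θ * variance p g + ℓ / (N * θ)))) *
        Real.exp (N * (θ ^ 2 * variance p g)) :=
        mul_le_mul_of_nonneg_left hmgf (Real.exp_pos _).le
    _ = Real.exp (-ℓ) := by
        rw [← Real.exp_add]
        congr 1
        field_simp
        ring

/-- The rows of the empirical model are good, for a fixed value function. -/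
lemma measure_not_rowGood_le (P : PMF S) {N : ℕ} (hN : 0 < N) {γ b η ℓ : ℝ} (hγ0 : 0 ≤ γ)
    (hγ1 : γ < 1) (hb : 0 < b) (hη0 : 0 < η) (hη1 : η ≤ 1) (hη : η ^ 2 = ℓ * b / N)
    {v : S → ℝ} (hv0 : ∀ s, 0 ≤ v s) (hv : ∀ s, v s ≤ b) :
    (Measure.pi fun _ : Fin N => P.toMeasure)
      {y | ¬ RowGood γ b η (fun s => (P s).toReal) (empRow y) v} ≤
        3 * ENNReal.ofReal (Real.exp (-ℓ)) := by
  have hP := toReal_mem_stdSimplex P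
  set p : S → ℝ := fun s => (P s).toReal with hp
  have hN' : (0 : ℝ) < N := by exact_mod_cast hN
  have hvar := variance_nonneg hP v
  -- The values of `θ` below carry a factor `γ`, so `γ = 0` is treated apart; there the row bounds
  -- are trivial.
  rcases hγ0.eq_or_lt with rfl | hγ
  · have : ∀ y : Fin N → S, RowGood 0 b η p (empRow y) v := fun y =>
      ⟨by rw [zero_mul]; positivity, by rw [zero_mul]; positivity, by rw [zero_mul]; positivity⟩
    simp [this]
  have hℓ : ℓ / N = η ^ 2 / b := by rw [hη]; field_simp
  have hsq0 : ∀ s, 0 ≤ v s ^ 2 := fun s => sq_nonneg _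
  have hsq : ∀ s, v s ^ 2 ≤ b ^ 2 := fun s => pow_le_pow_left₀ (hv0 s) (hv s) 2
  -- These two values of `θ` produce the coefficients of `RowGood` after multiplication by `γ`: the
  -- first for `v` and `-v`, the second for `-v ^ 2`, whose variance is at most `4 * b ^ 2` times
  -- that of `v`.
  have hθ1 : 0 < γ * η / (2 * b) := by positivity
  have hθ2 : 0 < γ / (16 * b ^ 2) := by positivity
  have e1 : ℓ / (N * (γ * η / (2 * b))) = 2 * η / γ := by
    rw [← div_div, hℓ]
    field_simp
  have e2 : ℓ / (N * (γ / (16 * b ^ 2))) = 16 * b * η ^ 2 / γ := by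
    rw [← div_div, hℓ]
    field_simp
  have b1 : ∀ s, |γ * η / (2 * b) * (v s - ∑ s, p s * v s)| ≤ 1 := fun s => by
    rw [abs_mul, abs_of_pos hθ1]
    calc _ ≤ γ * η / (2 * b) * b :=
          mul_le_mul_of_nonneg_left (abs_sub_le_of_mem hP hv0 hv s) hθ1.le
      _ = γ * η / 2 := by field_simp
      _ ≤ 1 := by nlinarith
  have b2 : ∀ s, |γ / (16 * b ^ 2) * (v s ^ 2 - ∑ s, p s * v s ^ 2)| ≤ 1 := fun s => by
    rw [abs_mul, abs_of_pos hθ2]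
    calc _ ≤ γ / (16 * b ^ 2) * b ^ 2 :=
          mul_le_mul_of_nonneg_left (abs_sub_le_of_mem hP hsq0 hsq s) hθ2.le
      _ = γ / 16 := by field_simp
      _ ≤ 1 := by linarith
  have neg_sum : ∀ q g : S → ℝ, ∑ s, q s * -g s = -∑ s, q s * g s := fun q g => by simp
  have m1 := measure_mean_sub_le P hN v (ℓ := ℓ) hθ1 b1
  have m2 := measure_mean_sub_le P hN (fun s => - v s) (ℓ := ℓ) hθ1 (fun s => by
    rw [neg_sum, sub_neg_eq_add, neg_add_eq_sub, ← abs_neg, ← mul_neg, neg_sub]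
    exact b1 s)
  have m3 := measure_mean_sub_le P hN (fun s => - v s ^ 2) (ℓ := ℓ) hθ2 (fun s => by
    rw [neg_sum, sub_neg_eq_add, neg_add_eq_sub, ← abs_neg, ← mul_neg, neg_sub]
    exact b2 s)
  rw [variance_neg] at m2 m3
  simp_rw [neg_sum] at m2 m3
  rw [e1] at m1 m2
  rw [e2] at m3
  have hunion := (measure_union_le _ _).trans (add_le_add m1 ((measure_union_le _ _).trans
    (add_le_add m2 m3)))
  refine (measure_mono fun y hy => ?_).trans (hunion.trans (le_of_eq (by ring)))
  · by_contra hcon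
    simp only [Set.mem_union, not_or, Set.mem_ofPred_eq, not_lt, ← hp] at hcon
    obtain ⟨n1', n2', n3'⟩ := hcon
    refine hy ⟨?_, ?_, ?_⟩
    · calc _ ≤ γ * _ := mul_le_mul_of_nonneg_left n1' hγ0
        _ = _ := by field_simp
    · calc _ = γ * (-∑ s, empRow y s * v s - -∑ s, p s * v s) := by ring
        _ ≤ γ * _ := mul_le_mul_of_nonneg_left n2' hγ0
        _ = _ := by field_simp
    · have h4 := variance_sq_le hP hv0 hv
      calc _ = γ * (-∑ s, empRow y s * v s ^ 2 - -∑ s, p s * v s ^ 2) := by ring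
        _ ≤ γ * _ := mul_le_mul_of_nonneg_left n3' hγ0
        _ ≤ γ * (γ / (16 * b ^ 2) * (4 * b ^ 2 * variance p v) + 16 * b * η ^ 2 / γ) := by
            gcongr
        _ = _ := by field_simp; ring

end

/-! ### Separation by perturbation, and rows independent of the policy. -/

section

/-- The uniform law on `[0, ω]`. -/
abbrev unif (ω : ℝ) : Measure ℝ :=
  ProbabilityTheory.cond (volume : Measure ℝ) (Set.Icc 0 ω)

lemma isProbabilityMeasure_unif {ω : ℝ} (hω : 0 < ω) : IsProbabilityMeasure (unif ω) := by
  refine ProbabilityTheory.cond_isProbabilityMeasure_of_finite ?_ ?_ <;> simp [hω]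

/-- `D` grows with slope at least `κ`, so the points where `|D| < g` lie within `2 * g / κ` of each
other. -/
lemma unif_abs_lt_le {ω : ℝ} (hω : 0 < ω) {κ g : ℝ} (hκ : 0 < κ) {D : ℝ → ℝ}
    (hD : ∀ y y', y ≤ y' → κ * (y' - y) ≤ D y' - D y) :
    unif ω {y | |D y| < g} ≤ ENNReal.ofReal (2 * g / (κ * ω)) := by
  have hdiam : Metric.ediam (Set.Icc 0 ω ∩ {y | |D y| < g}) ≤ ENNReal.ofReal (2 * g / κ) := by
    have key : ∀ y y', |D y| < g → |D y'| < g → y ≤ y' →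
        edist y y' ≤ ENNReal.ofReal (2 * g / κ) := fun y y' h h' hyy => by
      rw [edist_dist, Real.dist_eq, abs_sub_comm, abs_of_nonneg (sub_nonneg.2 hyy)]
      refine ENNReal.ofReal_le_ofReal ?_
      rw [le_div_iff₀ hκ]
      linarith [hD y y' hyy, (abs_lt.1 h).1, (abs_lt.1 h').2]
    refine Metric.ediam_le fun y hy y' hy' => ?_
    rcases le_total y y' with h | h
    · exact key y y' hy.2 hy'.2 h
    · rw [edist_comm]
      exact key y' y hy'.2 hy.2 h
  rw [ProbabilityTheory.cond_apply measurableSet_Icc, Real.volume_Icc, sub_zero]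
  calc _ ≤ (ENNReal.ofReal ω)⁻¹ * ENNReal.ofReal (2 * g / κ) := by
        gcongr
        exact (Real.volume_le_diam _).trans hdiam
    _ = ENNReal.ofReal (2 * g / (κ * ω)) := by
        rw [← ENNReal.ofReal_inv_of_pos hω, ← ENNReal.ofReal_mul (by positivity)]
        congr 1
        field_simp

/-- Both orders of integration are needed: the gap is estimated with the samples frozen, the rows
with the perturbations frozen. -/
lemma measure_prod_le_of_left {X Y : Type*} [MeasurableSpace X] [MeasurableSpace Y]
    {μ : Measure X} {ν : Measure Y} [IsProbabilityMeasure μ] [SFinite ν] {Q : X → Y → Prop}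
    (hQ : MeasurableSet {q : X × Y | Q q.1 q.2}) {k : ENNReal} (h : ∀ x, ν {y | Q x y} ≤ k) :
    μ.prod ν {q | Q q.1 q.2} ≤ k := by
  rw [Measure.prod_apply hQ]
  refine (lintegral_mono h).trans ?_
  simp

lemma measure_prod_le_of_right {X Y : Type*} [MeasurableSpace X] [MeasurableSpace Y]
    {μ : Measure X} {ν : Measure Y} [SFinite μ] [IsProbabilityMeasure ν] {Q : X → Y → Prop}
    (hQ : MeasurableSet {q : X × Y | Q q.1 q.2}) {k : ENNReal} (h : ∀ y, μ {x | Q x y} ≤ k) :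
    μ.prod ν {q | Q q.1 q.2} ≤ k := by
  rw [Measure.prod_apply_symm hQ]
  refine (lintegral_mono h).trans ?_
  simp

lemma measure_exists_le {X I : Type*} [MeasurableSpace X] [Fintype I] (μ : Measure X)
    {Q : I → X → Prop} {k : I → ENNReal} (h : ∀ i, μ {x | Q i x} ≤ k i) :
    μ {x | ∃ i, Q i x} ≤ ∑ i, k i := by
  have : {x | ∃ i, Q i x} = ⋃ i, {x | Q i x} := by ext; simp
  rw [this]
  exact (measure_iUnion_fintype_le μ _).trans (Finset.sum_le_sum fun i _ => h i)

lemma measure_exists_le_card_mul {X I : Type*} [MeasurableSpace X] [Fintype I] (μ : Measure X)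
    {Q : I → X → Prop} {k : ENNReal} (h : ∀ i, μ {x | Q i x} ≤ k) :
    μ {x | ∃ i, Q i x} ≤ Fintype.card I * k :=
  (measure_exists_le μ h).trans (by simp)

variable {S A : Type*} [Fintype S] [Fintype A]

lemma continuous_add_perturbation {S A : Type*} (f : S → A → ℝ) :
    Continuous fun ξ : S → A → ℝ => fun s a => f s a + ξ s a := by
  fun_prop

lemma measurable_hasGap [Nonempty A] {p : S → A → S → ℝ} (hp : IsKernel p) {γ : ℝ}
    (hγ0 : 0 ≤ γ) (hγ1 : γ < 1) (f : S → A → ℝ) (g : ℝ) :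
    Measurable fun ξ : S → A → ℝ => HasGap p γ (fun s a => f s a + ξ s a) g := by
  have hc : ∀ s a, Measurable fun ξ : S → A → ℝ =>
      optActionValue p γ (fun s a => f s a + ξ s a) s a := fun s a =>
    ((continuous_optActionValue hp hγ0 hγ1 s a).comp (continuous_add_perturbation f)).measurable
  refine Measurable.forall fun s => Measurable.forall fun a => Measurable.forall fun a' =>
    Measurable.imp measurable_const (measurableSet_setOfPred.1 ?_)
  exact measurableSet_le measurable_const (continuous_abs.measurable.comp ((hc s a).sub (hc s a')))

lemma measurable_isGreedy [Nonempty A] {p : S → A → S → ℝ} (hp : IsKernel p) {γ : ℝ}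
    (hγ0 : 0 ≤ γ) (hγ1 : γ < 1) (f : S → A → ℝ) (m : S → A) :
    Measurable fun ξ : S → A → ℝ => IsGreedy p γ (fun s a => f s a + ξ s a) m := by
  have hc : ∀ s a, Measurable fun ξ : S → A → ℝ =>
      optActionValue p γ (fun s a => f s a + ξ s a) s a := fun s a =>
    ((continuous_optActionValue hp hγ0 hγ1 s a).comp (continuous_add_perturbation f)).measurable
  refine Measurable.forall fun s => Measurable.forall fun a => measurableSet_setOfPred.1 ?_
  exact measurableSet_le (hc s a) (hc s (m s))

lemma measurable_rowGood {Y : Type*} [MeasurableSpace Y] {v : Y → S → ℝ}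
    (hv : ∀ s, Measurable fun y => v y s) (γ b η : ℝ) (p q : S → ℝ) :
    Measurable fun y => RowGood γ b η p q (v y) := by
  have h : (fun y => RowGood γ b η p q (v y)) = fun y =>
      (γ * (∑ s, q s * v y s - ∑ s, p s * v y s) ≤
        η / (2 * b) * (γ ^ 2 * variance p (v y)) + 2 * η) ∧
      (γ * (∑ s, p s * v y s - ∑ s, q s * v y s) ≤
        η / (2 * b) * (γ ^ 2 * variance p (v y)) + 2 * η) ∧
      (γ * (∑ s, p s * v y s ^ 2 - ∑ s, q s * v y s ^ 2) ≤
        1 / 4 * (γ ^ 2 * variance p (v y)) + 16 * b * η ^ 2) := by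
    funext y
    exact propext ⟨fun h => ⟨h.1, h.2, h.3⟩, fun h => ⟨h.1, h.2.1, h.2.2⟩⟩
  rw [h]
  unfold variance
  refine Measurable.and (measurableSet_setOfPred.1 ?_)
    (Measurable.and (measurableSet_setOfPred.1 ?_) (measurableSet_setOfPred.1 ?_)) <;> exact measurableSet_le (by fun_prop) (by fun_prop)

/-- Random perturbations of the rewards separate the optimal action values. -/
lemma measure_not_hasGap_le [Nonempty A] {p : S → A → S → ℝ} (hp : IsKernel p) {γ : ℝ}
    (hγ0 : 0 ≤ γ) (hγ1 : γ < 1) (f : S → A → ℝ) {ω : ℝ} (hω : 0 < ω) (g : ℝ) :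
    (Measure.pi fun _ : S => Measure.pi fun _ : A => unif ω)
      {ξ | ¬ HasGap p γ (fun s a => f s a + ξ s a) g} ≤
        Fintype.card (S × A × A) * ENNReal.ofReal (2 * g / ((1 - γ) * ω)) := by
  classical
  have := isProbabilityMeasure_unif hω
  have hsub : {ξ : S → A → ℝ | ¬ HasGap p γ (fun s a => f s a + ξ s a) g} ⊆
      {ξ | ∃ i : S × A × A, i.2.1 ≠ i.2.2 ∧
        |optActionValue p γ (fun s a => f s a + ξ s a) i.1 i.2.1 -
          optActionValue p γ (fun s a => f s a + ξ s a) i.1 i.2.2| < g} := fun ξ hξ => by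
    have hξ' : ¬ HasGap p γ (fun s a => f s a + ξ s a) g := hξ
    unfold HasGap at hξ'
    push Not at hξ'
    obtain ⟨s, a, a', h⟩ := hξ'
    exact ⟨(s, a, a'), h⟩
  refine (measure_mono hsub).trans (measure_exists_le_card_mul _ fun ⟨s, a, a'⟩ => ?_)
  by_cases haa : a = a'
  · simp [haa]
  simp only [ne_eq, haa, not_false_eq_true, true_and]
  have hc : ∀ s a, Measurable fun ξ : S → A → ℝ =>
      optActionValue p γ (fun s a => f s a + ξ s a) s a := fun s a =>
    ((continuous_optActionValue hp hγ0 hγ1 s a).comp (continuous_add_perturbation f)).measurable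
  -- Only the perturbation at `(s, a)` varies; `IsOptValue.expand` gives the slope `1 - γ`.
  refine pi_pi_le_of_forall_update (fun _ _ => unif ω) (measurableSet_lt
    (continuous_abs.measurable.comp ((hc s a).sub (hc s a'))) measurable_const) s a fun ξ => ?_
  refine unif_abs_lt_le hω (sub_pos.2 hγ1) (D := fun y =>
    optActionValue p γ (fun s' b => f s' b +
      Function.update ξ s (Function.update (ξ s) a y) s' b) s a -
    optActionValue p γ (fun s' b => f s' b +
      Function.update ξ s (Function.update (ξ s) a y) s' b) s a') fun y y' hyy => ?_
  refine (isOptValue_optValue hp hγ0 hγ1 _).expand hp hγ0 hγ1 (isOptValue_optValue hp hγ0 hγ1 _)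
    haa (fun s' b hsb => ?_) (sub_nonneg.2 hyy) ?_
  · simp only [ne_eq, Prod.mk.injEq] at hsb
    simp only [update_update_apply, if_neg hsb]
  · simp only [update_update_apply, and_self, if_true]
    ring

lemma exists_grid_near {B h : ℝ} (hh : 0 < h) {K : ℕ} (hK : 2 * B / h ≤ K) {t : ℝ}
    (ht : |t| ≤ B) : ∃ k : Fin (K + 1), |-B + k * h - t| ≤ h := by
  obtain ⟨h1, h2⟩ := abs_le.1 ht
  have h0 : 0 ≤ (t + B) / h := div_nonneg (by linarith) hh.le
  have hle : (t + B) / h ≤ K := le_trans (by gcongr; linarith) hK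
  refine ⟨⟨⌊(t + B) / h⌋₊, Nat.lt_succ_of_le (Nat.floor_le_of_le hle)⟩, ?_⟩
  have h3 := Nat.floor_le h0
  have h4 := Nat.lt_floor_add_one ((t + B) / h)
  rw [le_div_iff₀ hh] at h3
  rw [div_lt_iff₀ hh] at h4
  rw [abs_le]
  constructor <;> simp only <;> linarith

/-- The value function of a deterministic policy. -/
def detValue [DecidableEq S] [DecidableEq A] (p : S → A → S → ℝ) (γ : ℝ) (m : S → A)
    (l : S → A → ℝ) : S → ℝ :=
  fun s => value p γ (detPolicy m) l (Pi.single s 1)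

lemma detValue_mem [DecidableEq S] [DecidableEq A] {p : S → A → S → ℝ} (hp : IsKernel p) {γ : ℝ}
    (hγ0 : 0 ≤ γ) (hγ1 : γ < 1) (m : S → A) {l : S → A → ℝ}
    (hl : ∀ s a, l s a ∈ Set.Icc (0 : ℝ) 1) (s : S) :
    detValue p γ m l s ∈ Set.Icc 0 (1 / (1 - γ)) := by
  have hv : ∀ s, detValue p γ m l s = l s (m s) + γ * ∑ s', p s (m s) s' * detValue p γ m l s' :=
    value_detPolicy_single hp hγ0 hγ1 m l
  constructor
  · have := le_of_le_add_discount hγ0 hγ1 (K := 0) (w := fun s => - detValue p γ m l s)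
      (fun s => ⟨p s (m s), hp s _, by
        simp_rw [mul_neg, Finset.sum_neg_distrib]; linarith [hv s, (hl s (m s)).1]⟩) s
    rw [zero_div] at this
    linarith
  · exact le_of_le_add_discount hγ0 hγ1
      (fun s => ⟨p s (m s), hp s _, by linarith [hv s, (hl s (m s)).2]⟩) s

lemma isKernel_trueKernel {S A : Type*} [Fintype S] (P : S → A → PMF S) :
    IsKernel (trueKernel P) := fun s a =>
  toReal_mem_stdSimplex (P s a)

lemma isKernel_empKernel {S A : Type*} [Fintype S] [DecidableEq S] {N : ℕ} (hN : 0 < N)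
    (x : S → A → Fin N → S) :
    IsKernel (empKernel x) := fun s a => empRow_mem hN (x s a)

/-- The independence behind the decoupling: the absorbing model at `(s, a)` ignores the samples
drawn there. -/
lemma absorb_empKernel_update {S A : Type*} [DecidableEq S] [DecidableEq A] {N : ℕ}
    (x : S → A → Fin N → S) (s : S) (a : A) (y : Fin N → S) :
    absorb (empKernel (Function.update x s (Function.update (x s) a y))) s a =
      absorb (empKernel x) s a := by
  funext s' a'
  rw [absorb, absorb, update_update_apply, update_update_apply]
  split_ifs with h
  · rfl
  · funext s''
    rw [empKernel, empKernel, update_update_apply, if_neg h]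

variable [DecidableEq S] [DecidableEq A] [Nonempty A] [MeasurableSpace S]
  [MeasurableSingletonClass S]

/-- For fixed rewards, the empirical rows are good for the value of the greedy policy of the
empirical model, in spite of the dependence of this policy on the samples. -/
lemma measure_greedy_not_rowGood_le (P : S → A → PMF S) {N : ℕ} (hN : 0 < N) {γ η ℓ : ℝ}
    (hγ0 : 0 ≤ γ) (hγ1 : γ < 1) (hη0 : 0 < η) (hη1 : η ≤ 1)
    (hη : η ^ 2 = ℓ * (1 / (1 - γ)) / N) {f l : S → A → ℝ} {F g h : ℝ}
    (hf0 : ∀ s a, 0 ≤ f s a) (hf : ∀ s a, f s a ≤ F) (hl : ∀ s a, l s a ∈ Set.Icc (0 : ℝ) 1)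
    (hh : 0 < h) (hgh : 2 * h / (1 - γ) < g) {K : ℕ} (hK : 2 * (F / (1 - γ)) / h ≤ K) :
    (Measure.pi fun s : S => Measure.pi fun a : A => Measure.pi fun _ : Fin N =>
      (P s a).toMeasure) {x | HasGap (empKernel x) γ f g ∧ ∃ m, IsGreedy (empKernel x) γ f m ∧
        ∃ s, ¬ RowGood γ (1 / (1 - γ)) η (trueKernel P s (m s)) (empKernel x s (m s))
          (detValue (trueKernel P) γ m l)} ≤
      Fintype.card (S × A × Fin (K + 1)) * (3 * ENNReal.ofReal (Real.exp (-ℓ))) := by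
  have hb : 0 < 1 / (1 - γ) := one_div_pos.2 (sub_pos.2 hγ1)
  -- The candidate policies: for each `(s, a)`, one per grid reward, none depending on the samples
  -- at `(s, a)`. On the gap event the greedy policy `m` is among the candidates for every `(s, m
  -- s)`.
  let m' : S → A → Fin (K + 1) → (S → A → Fin N → S) → S → A := fun s a k x =>
    greedy (absorb (empKernel x) s a) γ (setReward f s a (-(F / (1 - γ)) + k * h))
  have hsub : {x | HasGap (empKernel x) γ f g ∧ ∃ m, IsGreedy (empKernel x) γ f m ∧
        ∃ s, ¬ RowGood γ (1 / (1 - γ)) η (trueKernel P s (m s)) (empKernel x s (m s))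
          (detValue (trueKernel P) γ m l)} ⊆
      {x : S → A → Fin N → S | ∃ i : S × A × Fin (K + 1), ¬ RowGood γ (1 / (1 - γ)) η
        (trueKernel P i.1 i.2.1) (empKernel x i.1 i.2.1)
          (detValue (trueKernel P) γ (m' i.1 i.2.1 i.2.2 x) l)} := by
    rintro x ⟨hg, m, hm, s, hs⟩
    have hp := isKernel_empKernel hN x
    obtain ⟨k, hk⟩ := exists_grid_near hh hK (abs_absorbReward_le hp hγ0 hγ1 hf0 hf s (m s))
    have := hm.eq_of_absorb hp hγ0 hγ1 hg hgh hk (isGreedy_greedy _ γ _)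
    refine ⟨(s, m s, k), ?_⟩
    simp only [m']
    rwa [this]
  refine (measure_mono hsub).trans (measure_exists_le_card_mul _ fun ⟨s, a, k⟩ => ?_)
  refine pi_pi_le_of_forall_update (fun s a => Measure.pi fun _ : Fin N => (P s a).toMeasure)
    (Set.toFinite _).measurableSet s a fun x => ?_
  have hmem := detValue_mem (isKernel_trueKernel P) hγ0 hγ1 (m' s a k x) hl
  have := measure_not_rowGood_le (P s a) hN hγ0 hγ1 hb hη0 hη1 hη (fun s => (hmem s).1)
    (fun s => (hmem s).2)
  refine le_trans (measure_mono fun y hy => ?_) this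
  simp only [Set.mem_ofPred_eq, m', absorb_empKernel_update] at hy
  have hrow : empKernel (Function.update x s (Function.update (x s) a y)) s a = empRow y := by
    funext s'
    simp [empKernel, empRow]
  rw [hrow] at hy
  exact hy

end

/-! ### The good event and its probability. -/

section

variable {S A : Type*} [Fintype S] [Fintype A]

lemma measure_unif_notMem {ω : ℝ} : unif ω {y | y ∉ Set.Icc 0 ω} = 0 := by
  rw [ProbabilityTheory.cond_apply measurableSet_Icc]
  have : Set.Icc 0 ω ∩ {y | y ∉ Set.Icc 0 ω} = ∅ := Set.inter_compl_self _
  rw [this]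
  simp

lemma measurable_forall_mem_Icc (ω : ℝ) :
    Measurable fun ξ : S → A → ℝ => ∀ s a, ξ s a ∈ Set.Icc 0 ω := by
  refine Measurable.forall fun s => Measurable.forall fun a => measurableSet_setOfPred.1 ?_
  have : Measurable fun ξ : S → A → ℝ => ξ s a := by fun_prop
  exact this measurableSet_Icc

lemma measure_not_forall_mem_Icc {ω : ℝ} (hω : 0 < ω) :
    (Measure.pi fun _ : S => Measure.pi fun _ : A => unif ω)
      {ξ | ¬ ∀ s a, ξ s a ∈ Set.Icc 0 ω} = 0 := by
  classical
  have := isProbabilityMeasure_unif hω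
  have hset : {ξ : S → A → ℝ | ¬ ∀ s a, ξ s a ∈ Set.Icc 0 ω} =
      {ξ | ∃ i : S × A, ξ i.1 i.2 ∉ Set.Icc 0 ω} := by
    ext ξ
    simp only [Set.mem_ofPred_eq, not_forall, Prod.exists]
  rw [hset]
  refine le_antisymm ((measure_exists_le _ (k := 0) fun ⟨s, a⟩ => ?_).trans (by simp)) bot_le
  have hm : Measurable fun ξ : S → A → ℝ => ξ s a := by fun_prop
  refine pi_pi_le_of_forall_update (fun _ _ => unif ω) (hm measurableSet_Icc.compl) s a fun x => ?_
  refine le_trans (le_of_eq ?_) (measure_unif_notMem (ω := ω)).le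
  congr 1
  ext y
  simp

lemma sampleMeasure_le_of_forall_samples [MeasurableSpace S] (P : S → A → PMF S) {N : ℕ} {ω : ℝ}
    (hω : 0 < ω)
    {Q : (S → A → Fin N → S) → (S → A → ℝ) → Prop}
    (hQ : MeasurableSet {q : Sample S A N | Q q.1 q.2}) {k : ENNReal}
    (h : ∀ x, (Measure.pi fun _ : S => Measure.pi fun _ : A => unif ω) {ξ | Q x ξ} ≤ k) :
    sampleMeasure P N ω {q | Q q.1 q.2} ≤ k := by
  have := isProbabilityMeasure_unif hω
  exact measure_prod_le_of_left hQ h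

lemma sampleMeasure_le_of_forall_perturbations [MeasurableSpace S] (P : S → A → PMF S) {N : ℕ}
    {ω : ℝ} (hω : 0 < ω)
    {Q : (S → A → Fin N → S) → (S → A → ℝ) → Prop}
    (hQ : MeasurableSet {q : Sample S A N | Q q.1 q.2}) {k : ENNReal}
    (h : ∀ ξ, (Measure.pi fun s : S => Measure.pi fun a : A => Measure.pi fun _ : Fin N =>
      (P s a).toMeasure) {x | Q x ξ} ≤ k) :
    sampleMeasure P N ω {q | Q q.1 q.2} ≤ k := by
  have := isProbabilityMeasure_unif hω
  exact measure_prod_le_of_right hQ h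

variable [DecidableEq S] [DecidableEq A]

/-- The random inputs for which the perturbations are in range, the optimal action values of all
objectives are separated, and the empirical rows are good for all greedy policies and all
rewards that are to be evaluated. -/
def goodEvent {I J : Type*} (P : S → A → PMF S) (N : ℕ) (γ ω g : ℝ) (f : I → S → A → ℝ)
    (l : J → (S → A → ℝ) → S → A → ℝ) (η : J → ℝ) : Set (Sample S A N) :=
  {q | (∀ s a, q.2 s a ∈ Set.Icc 0 ω) ∧
    (∀ i, HasGap (empKernel q.1) γ (fun s a => f i s a + q.2 s a) g) ∧
    ∀ i m, IsGreedy (empKernel q.1) γ (fun s a => f i s a + q.2 s a) m → ∀ j s,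
      RowGood γ (1 / (1 - γ)) (η j) (trueKernel P s (m s)) (empKernel q.1 s (m s))
        (detValue (trueKernel P) γ m (l j q.2))}

lemma measurable_detValue {p : S → A → S → ℝ} (hp : IsKernel p) {γ : ℝ} (hγ0 : 0 ≤ γ)
    (hγ1 : γ < 1) (m : S → A) {l : (S → A → ℝ) → S → A → ℝ} (hl : Continuous l) (s : S) :
    Measurable fun ξ => detValue p γ m (l ξ) s :=
  ((continuous_value hp hγ0 hγ1 (isPolicy_detPolicy m) (single_mem_stdSimplex ℝ s)).comp
    hl).measurable

variable [MeasurableSpace S] [MeasurableSingletonClass S] [Nonempty A]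

/-- There are finitely many sample tables, so only measurability in the perturbation is at stake. -/
lemma measurableSet_goodEvent {I J : Type*} [Countable I] [Countable J] (P : S → A → PMF S)
    {N : ℕ} (hN : 0 < N) {γ : ℝ} (hγ0 : 0 ≤ γ) (hγ1 : γ < 1) (ω g : ℝ) (f : I → S → A → ℝ)
    {l : J → (S → A → ℝ) → S → A → ℝ} (hl : ∀ j, Continuous (l j)) (η : J → ℝ) :
    MeasurableSet (goodEvent P N γ ω g f l η) := by
  refine measurableSet_setOfPred.2 (measurable_from_prod_countable_right fun x => ?_)
  have hp := isKernel_empKernel hN x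
  refine (measurable_forall_mem_Icc ω).and ((Measurable.forall fun i =>
    measurable_hasGap hp hγ0 hγ1 (f i) g).and (Measurable.forall fun i => Measurable.forall fun m =>
      (measurable_isGreedy hp hγ0 hγ1 (f i) m).imp (Measurable.forall fun j =>
        Measurable.forall fun s => measurable_rowGood (fun s' =>
          measurable_detValue (isKernel_trueKernel P) hγ0 hγ1 m (hl j) s') γ (1 / (1 - γ)) (η j)
            (trueKernel P s (m s)) (empKernel x s (m s)))))

lemma measure_compl_goodEvent_le {I J : Type*} [Fintype I] [Fintype J] (P : S → A → PMF S)
    {N : ℕ} (hN : 0 < N) {γ : ℝ} (hγ0 : 0 ≤ γ) (hγ1 : γ < 1) {ω g h F : ℝ} (hω : 0 < ω)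
    (hg : 0 < g) {f : I → S → A → ℝ} (hf0 : ∀ i s a, 0 ≤ f i s a)
    (hf : ∀ i s a, f i s a + ω ≤ F) {l : J → (S → A → ℝ) → S → A → ℝ}
    (hlc : ∀ j, Continuous (l j))
    (hl : ∀ ξ : S → A → ℝ, (∀ s a, ξ s a ∈ Set.Icc 0 ω) → ∀ j s a, l j ξ s a ∈ Set.Icc (0 : ℝ) 1)
    {η ℓ : J → ℝ} (hη0 : ∀ j, 0 < η j) (hη1 : ∀ j, η j ≤ 1)
    (hη : ∀ j, η j ^ 2 = ℓ j * (1 / (1 - γ)) / N) (hh : 0 < h) (hgh : 2 * h / (1 - γ) < g)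
    {K : ℕ} (hK : 2 * (F / (1 - γ)) / h ≤ K) :
    sampleMeasure P N ω (goodEvent P N γ ω g f l η)ᶜ ≤ ENNReal.ofReal
      (Fintype.card I * (Fintype.card S * Fintype.card A ^ 2 * (2 * g / ((1 - γ) * ω))) +
        Fintype.card I * ∑ j, Fintype.card S * Fintype.card A * (K + 1) *
          (3 * Real.exp (-ℓ j))) := by
  have := isProbabilityMeasure_unif hω
  have hγ' : 0 < 1 - γ := sub_pos.2 hγ1
  have m1 : sampleMeasure P N ω {q | ¬ ∀ s a, q.2 s a ∈ Set.Icc 0 ω} ≤ 0 :=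
    sampleMeasure_le_of_forall_samples P hω
      (Q := fun (_ : S → A → Fin N → S) (ξ : S → A → ℝ) => ¬ ∀ s a, ξ s a ∈ Set.Icc 0 ω)
      (measurableSet_setOfPred.2 ((measurable_forall_mem_Icc ω).not.comp measurable_snd))
      fun x => (measure_not_forall_mem_Icc hω).le
  have m2 : sampleMeasure P N ω
      {q | ∃ i, ¬ HasGap (empKernel q.1) γ (fun s a => f i s a + q.2 s a) g} ≤
      Fintype.card I *
        (Fintype.card (S × A × A) * ENNReal.ofReal (2 * g / ((1 - γ) * ω))) := by
    have hgap : ∀ i, sampleMeasure P N ω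
        {q | ¬ HasGap (empKernel q.1) γ (fun s a => f i s a + q.2 s a) g} ≤
          Fintype.card (S × A × A) * ENNReal.ofReal (2 * g / ((1 - γ) * ω)) := fun i => by
      have hmeas : MeasurableSet {q : Sample S A N |
          ¬ HasGap (empKernel q.1) γ (fun s a => f i s a + q.2 s a) g} :=
        measurableSet_setOfPred.2 (measurable_from_prod_countable_right fun x =>
          (measurable_hasGap (isKernel_empKernel hN x) hγ0 hγ1 (f i) g).not)
      have h2 := fun x : S → A → Fin N → S =>
        measure_not_hasGap_le (isKernel_empKernel hN x) hγ0 hγ1 (f i) hω g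
      have h3 := sampleMeasure_le_of_forall_samples P hω
        (Q := fun (x : S → A → Fin N → S) (ξ : S → A → ℝ) =>
          ¬ HasGap (empKernel x) γ (fun s a => f i s a + ξ s a) g) hmeas h2
      exact h3
    have h4 := measure_exists_le_card_mul (sampleMeasure P N ω)
      (Q := fun i q => ¬ HasGap (empKernel q.1) γ (fun s a => f i s a + q.2 s a) g) hgap
    exact h4
  let Q : I → J → (S → A → Fin N → S) → (S → A → ℝ) → Prop := fun i j x ξ =>
    (∀ s a, ξ s a ∈ Set.Icc 0 ω) ∧ HasGap (empKernel x) γ (fun s a => f i s a + ξ s a) g ∧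
      ∃ m, IsGreedy (empKernel x) γ (fun s a => f i s a + ξ s a) m ∧
        ∃ s, ¬ RowGood γ (1 / (1 - γ)) (η j) (trueKernel P s (m s)) (empKernel x s (m s))
          (detValue (trueKernel P) γ m (l j ξ))
  have m3 : sampleMeasure P N ω {q | ∃ i j, Q i j q.1 q.2} ≤
      Fintype.card I * ∑ j, Fintype.card (S × A × Fin (K + 1)) *
        (3 * ENNReal.ofReal (Real.exp (-ℓ j))) := by
    refine measure_exists_le_card_mul _
      (Q := fun i (q : Sample S A N) => ∃ j, Q i j q.1 q.2) fun i =>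
      measure_exists_le _ (Q := fun j (q : Sample S A N) => Q i j q.1 q.2) fun j => ?_
    refine sampleMeasure_le_of_forall_perturbations P hω (Q := Q i j) (measurableSet_setOfPred.2
      (measurable_from_prod_countable_right fun x => ?_)) fun ξ => ?_
    · have hp := isKernel_empKernel hN x
      exact (measurable_forall_mem_Icc ω).and ((measurable_hasGap hp hγ0 hγ1 (f i) g).and
        (Measurable.exists fun m => (measurable_isGreedy hp hγ0 hγ1 (f i) m).and
          (Measurable.exists fun s => (measurable_rowGood (fun s' =>
            measurable_detValue (isKernel_trueKernel P) hγ0 hγ1 m (hlc j) s') γ (1 / (1 - γ)) (η j)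
            (trueKernel P s (m s)) (empKernel x s (m s))).not)))
    · by_cases hξ : ∀ s a, ξ s a ∈ Set.Icc 0 ω
      · refine (measure_mono fun x hx => ?_).trans (measure_greedy_not_rowGood_le P hN hγ0 hγ1
          (hη0 j) (hη1 j) (hη j) (f := fun s a => f i s a + ξ s a) (F := F) (g := g) (h := h)
          (fun s a => add_nonneg (hf0 i s a) (hξ s a).1)
          (fun s a => (by gcongr; exact (hξ s a).2 : f i s a + ξ s a ≤ f i s a + ω).trans
            (hf i s a)) (hl ξ hξ j) hh hgh hK)
        exact hx.2
      · have : {x | Q i j x ξ} = ∅ := Set.eq_empty_of_forall_notMem fun x hx => hξ hx.1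
        rw [this]
        simp
  have hsub : (goodEvent P N γ ω g f l η)ᶜ ⊆ {q | ¬ ∀ s a, q.2 s a ∈ Set.Icc 0 ω} ∪
      ({q | ∃ i, ¬ HasGap (empKernel q.1) γ (fun s a => f i s a + q.2 s a) g} ∪
        {q | ∃ i j, Q i j q.1 q.2}) := by
    intro q hq
    by_contra hcon
    simp only [Set.mem_union, not_or, Set.mem_ofPred_eq, not_not, not_exists] at hcon
    obtain ⟨h1, h2, h3⟩ := hcon
    refine hq ⟨h1, h2, fun i m hm j s => ?_⟩
    by_contra hs
    exact h3 i j ⟨h1, h2 i, m, hm, s, hs⟩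
  refine (measure_mono hsub).trans ((measure_union_le _ _).trans ((add_le_add m1
    ((measure_union_le _ _).trans (add_le_add m2 m3))).trans (le_of_eq ?_)))
  have e0 : 0 ≤ 2 * g / ((1 - γ) * ω) := by positivity
  have e1 : ∀ j, ENNReal.ofReal ((Fintype.card S : ℝ) * Fintype.card A * (K + 1) *
      (3 * Real.exp (-ℓ j))) = Fintype.card (S × A × Fin (K + 1)) *
        (3 * ENNReal.ofReal (Real.exp (-ℓ j))) := fun j => by
    rw [ENNReal.ofReal_mul (by positivity), ENNReal.ofReal_mul (p := 3) (by positivity)]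
    congr 1
    · rw [← ENNReal.ofReal_natCast]
      congr 1
      simp only [Fintype.card_prod, Fintype.card_fin, Nat.cast_mul]
      push_cast
      ring
    · simp
  have e2 : ENNReal.ofReal ((Fintype.card S : ℝ) * (Fintype.card A : ℝ) ^ 2) =
      Fintype.card (S × A × A) := by
    rw [← ENNReal.ofReal_natCast]
    congr 1
    simp only [Fintype.card_prod, Nat.cast_mul]
    ring
  rw [zero_add, ENNReal.ofReal_add (by positivity) (by positivity)]
  congr 1
  · rw [ENNReal.ofReal_mul (by positivity), ENNReal.ofReal_mul (by positivity), e2,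
      ENNReal.ofReal_natCast]
  · rw [ENNReal.ofReal_mul (by positivity), ENNReal.ofReal_natCast,
      ENNReal.ofReal_sum_of_nonneg fun _ _ => by positivity]
    simp_rw [e1]

end

/-! ### Numerical constants, runs and mixtures. -/

section

/-- The choice of the gap, of the grid and of the confidence levels keeps the total failure
probability below `δ / 5`. -/
lemma failure_le {s a M F ω δ κ G g : ℝ} {d K : ℕ} (hd : 1 ≤ d) (hs : 1 ≤ s) (ha : 1 ≤ a)
    (hM : 1 ≤ M) (hF : 1 ≤ F) (hω0 : 0 < ω) (hω1 : ω ≤ 1) (hδ0 : 0 < δ) (hδ1 : δ < 1)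
    (hκ0 : 0 < κ) (hκ1 : κ ≤ 1)
    (hG : 9720 * (M ^ 2 * (F * s ^ 2 * a ^ 3 / (κ ^ 3 * ω * δ ^ 2))) ≤ G ^ 4) (hG0 : 0 < G)
    (hg : g = δ * κ * ω / (20 * M * s * a ^ 2))
    (hK : (K : ℝ) ≤ 2 * (F / κ) / (g * κ / 4) + 1) :
    M * (s * a ^ 2 * (2 * g / (κ * ω))) +
      M * (s * a * (K + 1) * (3 * (G ^ 4)⁻¹) + d * (s * a * (K + 1) * (3 * ((d * G) ^ 4)⁻¹))) ≤
        δ / 5 := by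
  have hd' : (1 : ℝ) ≤ d := by exact_mod_cast hd
  have hs0 : 0 < s := by linarith
  have ha0 : 0 < a := by linarith
  have hM0 : 0 < M := by linarith
  have hF0 : 0 < F := by linarith
  set X := F * M * s * a ^ 2 / (κ ^ 3 * ω * δ) with hX
  have hX1 : 1 ≤ X := by
    rw [hX, one_le_div (by positivity)]
    have h1 : κ ^ 3 * ω * δ ≤ 1 :=
      mul_le_one₀ (mul_le_one₀ (pow_le_one₀ hκ0.le hκ1) hω0.le hω1) hδ0.le hδ1.le
    have h2 : 1 ≤ F * M * s * a ^ 2 :=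
      one_le_mul_of_one_le_of_one_le (one_le_mul_of_one_le_of_one_le
        (one_le_mul_of_one_le_of_one_le hF hM) hs) (one_le_pow₀ ha)
    linarith
  -- `g` is chosen so that the gap fails with total bound exactly `δ / 10`; the other half is left
  -- to the rows.
  have e1 : M * (s * a ^ 2 * (2 * g / (κ * ω))) = δ / 10 := by
    rw [hg]
    field_simp
    norm_num
  have e2 : 2 * (F / κ) / (g * κ / 4) = 160 * X := by
    rw [hg, hX]
    field_simp
    norm_num
  have hK' : (K : ℝ) + 1 ≤ 162 * X := by linarith
  -- The level `δ / d` pays for the union bound over the `d` constraints.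
  have hdG : d * ((d * G) ^ 4)⁻¹ ≤ (G ^ 4)⁻¹ := by
    rw [mul_pow, mul_inv, ← mul_assoc]
    refine mul_le_of_le_one_left (by positivity) ?_
    rw [← div_eq_mul_inv, div_le_one (by positivity)]
    exact le_self_pow₀ hd' (by norm_num)
  have h3 : s * a * (K + 1) * (3 * (G ^ 4)⁻¹) + d * (s * a * (K + 1) * (3 * ((d * G) ^ 4)⁻¹)) ≤
      s * a * (162 * X) * (6 * (G ^ 4)⁻¹) := by
    calc _ = s * a * (K + 1) * (3 * (G ^ 4)⁻¹ + 3 * (d * ((d * G) ^ 4)⁻¹)) := by ring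
      _ ≤ s * a * (162 * X) * (3 * (G ^ 4)⁻¹ + 3 * (G ^ 4)⁻¹) := by gcongr
      _ = _ := by ring
  have h4 : M * (s * a * (162 * X) * (6 * (G ^ 4)⁻¹)) ≤ δ / 10 := by
    have h5 : M * (s * a * (162 * X) * (6 * (G ^ 4)⁻¹)) = 972 * (M * s * a * X) / G ^ 4 := by
      field_simp
      norm_num
    rw [h5, div_le_iff₀ (by positivity)]
    have h6 : 972 * (M * s * a * X) =
        δ / 10 * (9720 * (M ^ 2 * (F * s ^ 2 * a ^ 3 / (κ ^ 3 * ω * δ ^ 2)))) := by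
      rw [hX]
      field_simp
      norm_num
    rw [h6]
    exact mul_le_mul_of_nonneg_left hG (by positivity)
  rw [e1]
  linarith [mul_le_mul_of_nonneg_left h3 hM0.le]

/-- The union bound involves `m + 1` net points per coordinate, but the argument of the logarithm
contains only `m ^ d`. Since `m + 1 ≤ m ^ 2`, the fourth power of `G` makes up for this. -/
lemma le_gap_argument_pow {Z m lg G : ℝ} {d : ℕ} (hZ : 1 ≤ Z) (hm : 2 ≤ m) (hlg : 1 ≤ lg)
    (hG : G = 480 * Z * m ^ d * lg) : 9720 * (((m + 1) ^ d) ^ 2 * Z) ≤ G ^ 4 := by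
  have h1 : (m + 1) ^ d ≤ (m ^ d) ^ 2 := by
    rw [← pow_mul, mul_comm d 2, pow_mul]
    exact pow_le_pow_left₀ (by linarith) (by nlinarith) d
  have h2 : 480 * Z * m ^ d ≤ G := by
    rw [hG]
    exact le_mul_of_one_le_right (by positivity) hlg
  have h3 : ((m + 1) ^ d) ^ 2 ≤ (m ^ d) ^ 4 := by
    calc _ ≤ ((m ^ d) ^ 2) ^ 2 := pow_le_pow_left₀ (by positivity) h1 2
      _ = _ := by ring
  calc 9720 * (((m + 1) ^ d) ^ 2 * Z) ≤ 480 ^ 4 * ((m ^ d) ^ 4 * Z ^ 4) := by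
        have := le_self_pow₀ hZ (n := 4) (by norm_num)
        gcongr
        norm_num
    _ = (480 * Z * m ^ d) ^ 4 := by ring
    _ ≤ G ^ 4 := pow_le_pow_left₀ (by positivity) h2 4

lemma exists_eq_of_mem_net {U ε : ℝ} (hε : 0 < ε) {k₀ : ℕ} (hU : U = k₀ * ε) {y : ℝ}
    (hy : y ∈ net U ε) : ∃ k : Fin (k₀ + 1), y = (k : ℕ) * ε := by
  obtain ⟨k, rfl, hk⟩ := hy
  rw [hU] at hk
  have : (k : ℝ) ≤ k₀ := le_of_mul_le_mul_right hk hε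
  exact ⟨⟨k, Nat.lt_succ_of_le (by exact_mod_cast this)⟩, rfl⟩

variable {S A : Type*} [Fintype S] [Fintype A]

/-- All dual iterates lie in the net. -/
lemma IsRun.exists_lam_eq [DecidableEq S] {d : ℕ} {p : S → A → S → ℝ} {γ : ℝ} {ρ : S → ℝ}
    {rp : S → A → ℝ} {c : Fin d → S → A → ℝ} {b' : Fin d → ℝ} {U ε η : ℝ} {T : ℕ} {π : ℕ → S → A → ℝ}
    {lam : ℕ → Fin d → ℝ} (h : IsRun p γ ρ rp c b' U ε η T π lam) (hε : 0 < ε) {k₀ : ℕ}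
    (hU : U = k₀ * ε) {t : ℕ} (ht : t < T) :
    ∃ k : Fin d → Fin (k₀ + 1), lam t = fun i => ((k i : ℕ) : ℝ) * ε := by
  rcases t with _ | t
  · exact ⟨fun _ => 0, by rw [h.init]; ext; simp⟩
  · have := fun i => exists_eq_of_mem_net hε hU (h.dual t (Nat.lt_of_succ_lt ht) i).1
    choose k hk using this
    exact ⟨k, funext hk⟩

lemma abs_mixtureValue_sub_le {p q : S → A → S → ℝ} {γ : ℝ} {T : ℕ} (hT : 1 ≤ T)
    {π : ℕ → S → A → ℝ} {l : S → A → ℝ} {μ : S → ℝ} {B : ℝ}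
    (h : ∀ t < T, |value p γ (π t) l μ - value q γ (π t) l μ| ≤ B) :
    |mixtureValue p γ T π l μ - mixtureValue q γ T π l μ| ≤ B := by
  have hT' : (0 : ℝ) < T := by exact_mod_cast hT
  rw [mixtureValue, mixtureValue, ← mul_sub, ← Finset.sum_sub_distrib, abs_mul,
    abs_of_pos (by positivity), one_div_mul_eq_div, div_le_iff₀ hT']
  refine (Finset.abs_sum_le_sum_abs _ _).trans ((Finset.sum_le_sum fun t ht =>
    h t (Finset.mem_range.1 ht)).trans (le_of_eq ?_))
  simp [mul_comm]

lemma abs_value_detPolicy_sub_le [DecidableEq S] [DecidableEq A] {p q : S → A → S → ℝ}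
    (hp : IsKernel p) (hq : IsKernel q) {γ : ℝ} (hγ0 : 0 ≤ γ) (hγ1 : γ < 1) {η : ℝ} (hη0 : 0 ≤ η)
    (hη : η ^ 2 ≤ 1 / 72) {m : S → A} {l : S → A → ℝ} (hl : ∀ s a, l s a ∈ Set.Icc (0 : ℝ) 1)
    (hrow : ∀ s, RowGood γ (1 / (1 - γ)) η (p s (m s)) (q s (m s)) (detValue p γ m l))
    {μ : S → ℝ} (hμ : μ ∈ stdSimplex ℝ S) :
    |value p γ (detPolicy m) l μ - value q γ (detPolicy m) l μ| ≤ 7 / 2 * (1 / (1 - γ)) * η := by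
  have h : ∀ s, |detValue p γ m l s - detValue q γ m l s| ≤ 7 / 2 * (1 / (1 - γ)) * η :=
    abs_sub_le_of_rowGood hγ0 hγ1 rfl hη0 hη (fun s => hp s (m s)) (fun s => hq s (m s))
      (l := fun s => l s (m s)) (fun s => (hl s (m s)).1) (fun s => (hl s (m s)).2)
      (value_detPolicy_single hp hγ0 hγ1 m l) (value_detPolicy_single hq hγ0 hγ1 m l) hrow
  rw [value_eq_sum hp hγ0 hγ1 (isPolicy_detPolicy m),
    value_eq_sum hq hγ0 hγ1 (isPolicy_detPolicy m), ← Finset.sum_sub_distrib]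
  simp_rw [← mul_sub]
  rw [abs_le]
  exact ⟨le_sum_mul_of_le hμ fun s => (abs_le.1 (h s)).1,
    sum_mul_le_of_le hμ fun s => (abs_le.1 (h s)).2⟩

lemma isProbabilityMeasure_sampleMeasure [MeasurableSpace S] (P : S → A → PMF S) (N : ℕ) {ω : ℝ}
    (hω : 0 < ω) : IsProbabilityMeasure (sampleMeasure P N ω) := by
  have := isProbabilityMeasure_unif hω
  unfold sampleMeasure
  infer_instance

/-- The radius of the rows, for the logarithmic factor `C`. -/
lemma sqrt_bound {γ C N : ℝ} (hγ1 : γ < 1) (hC : 0 < C) (hN0 : 0 < N)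
    (hN : 4 * C / (1 - γ) ≤ N) :
    0 < √(C / 18 * (1 / (1 - γ)) / N) ∧
      √(C / 18 * (1 / (1 - γ)) / N) ^ 2 = C / 18 * (1 / (1 - γ)) / N ∧
      √(C / 18 * (1 / (1 - γ)) / N) ^ 2 ≤ 1 / 72 ∧
      √(C / 18 * (1 / (1 - γ)) / N) ≤ 1 ∧
      7 / 2 * (1 / (1 - γ)) * √(C / 18 * (1 / (1 - γ)) / N) ≤ √(C / (N * (1 - γ) ^ 3)) := by
  have hκ : 0 < 1 - γ := sub_pos.2 hγ1
  have h0 : 0 < C / 18 * (1 / (1 - γ)) / N := by positivity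
  have h1 := Real.sq_sqrt h0.le
  have h2 : C / 18 * (1 / (1 - γ)) / N ≤ 1 / 72 := by
    rw [div_le_iff₀ hN0]
    have : C / 18 * (1 / (1 - γ)) = 1 / 72 * (4 * C / (1 - γ)) := by ring
    rw [this]
    gcongr
  have hpos := Real.sqrt_pos.2 h0
  have h3 := h1.trans_le h2
  refine ⟨hpos, h1, h3, by nlinarith, ?_⟩
  refine Real.le_sqrt_of_sq_le ?_
  rw [mul_pow, h1]
  -- `(7 / 2) ^ 2 / 18 = 49 / 72 < 1`.
  have e1 : (7 / 2 * (1 / (1 - γ))) ^ 2 * (C / 18 * (1 / (1 - γ)) / N) =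
      49 / 72 * (C / (N * (1 - γ) ^ 3)) := by
    field_simp
    norm_num
  rw [e1]
  have : 0 ≤ C / (N * (1 - γ) ^ 3) := by positivity
  linarith

end

end CMDP

end

/-! ### Assembly of the theorem. -/

theorem theorem2 {S A : Type*} [Fintype S] [DecidableEq S] [Nonempty S]
    [MeasurableSpace S] [MeasurableSingletonClass S] [Fintype A] [Nonempty A]
    (d : ℕ) (hd : 1 ≤ d)
    (P : S → A → PMF S) (ρ : PMF S) (γ : ℝ) (hγ0 : 0 ≤ γ) (hγ1 : γ < 1)
    (r : S → A → ℝ) (hr : ∀ s a, r s a ∈ Set.Icc (0 : ℝ) 1)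
    (c : Fin d → S → A → ℝ) (hc : ∀ i s a, c i s a ∈ Set.Icc (0 : ℝ) 1)
    (b' : Fin d → ℝ)
    (ω : ℝ) (hω0 : 0 < ω) (hω1 : ω ≤ 1)
    (U ε₁ : ℝ) (hε₁ : 0 < ε₁) (hε₁U : ε₁ < U) (hU : ∃ k : ℕ, U = k * ε₁)
    (η : ℝ) (T : ℕ) (hT : 1 ≤ T)
    (δ : ℝ) (hδ0 : 0 < δ) (hδ1 : δ < 1)
    (ι : ℝ) (hι : ι = CMDP.gap (Fintype.card S) (Fintype.card A) d γ ω U ε₁ δ)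
    (C : ℝ → ℝ)
    (hC : ∀ δ', C δ' = CMDP.logFactor (Fintype.card S) (Fintype.card A) d γ ω U ι δ')
    (N : ℕ) (hN : 4 * C (δ / d) / (1 - γ) ≤ N) :
    ∃ E : Set (CMDP.Sample S A N), MeasurableSet E ∧
      ENNReal.ofReal (1 - δ / 5) ≤ CMDP.sampleMeasure P N ω E ∧
      ∀ x ξ, (x, ξ) ∈ E →
        ∀ (π : ℕ → S → A → ℝ) (lam : ℕ → Fin d → ℝ),
          CMDP.IsRun (CMDP.empKernel x) γ (fun s => (ρ s).toReal) (fun s a => r s a + ξ s a)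
            c b' U ε₁ η T π lam →
          |CMDP.mixtureValue (CMDP.trueKernel P) γ T π (fun s a => r s a + ξ s a)
                (fun s => (ρ s).toReal) -
              CMDP.mixtureValue (CMDP.empKernel x) γ T π (fun s a => r s a + ξ s a)
                (fun s => (ρ s).toReal)|
            ≤ 2 * Real.sqrt (C δ / (N * (1 - γ) ^ 3)) ∧
          ∀ i, |CMDP.mixtureValue (CMDP.trueKernel P) γ T π (c i) (fun s => (ρ s).toReal) -
              CMDP.mixtureValue (CMDP.empKernel x) γ T π (c i) (fun s => (ρ s).toReal)|
            ≤ Real.sqrt (C (δ / d) / (N * (1 - γ) ^ 3)) := by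
  classical
  obtain ⟨m₀, hm₀⟩ := hU
  have hκ : 0 < 1 - γ := sub_pos.2 hγ1
  have hm : (2 : ℝ) ≤ m₀ := by
    have h1 : (1 : ℝ) < m₀ := by
      rw [hm₀] at hε₁U
      by_contra hcon
      nlinarith
    have h2 : 1 < m₀ := by exact_mod_cast h1
    exact_mod_cast h2
  have hU0 : 0 < U := hε₁.trans hε₁U
  have hS : (1 : ℝ) ≤ Fintype.card S := by exact_mod_cast Fintype.card_pos
  have hA : (1 : ℝ) ≤ Fintype.card A := by exact_mod_cast Fintype.card_pos
  have hd' : (1 : ℝ) ≤ d := by exact_mod_cast hd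
  set F : ℝ := 1 + ω + d * U with hF
  have hF1 : 1 ≤ F := by
    have : 0 ≤ d * U := by positivity
    linarith
  set Z : ℝ := F * Fintype.card S ^ 2 * Fintype.card A ^ 3 / ((1 - γ) ^ 3 * ω * δ ^ 2) with hZ
  have hZ1 : 1 ≤ Z := by
    rw [hZ, one_le_div (by positivity)]
    have h1 : (1 - γ) ^ 3 * ω * δ ^ 2 ≤ 1 :=
      mul_le_one₀ (mul_le_one₀ (pow_le_one₀ hκ.le (by linarith)) hω0.le hω1) (by positivity)
        (pow_le_one₀ hδ0.le hδ1.le)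
    have h2 : 1 ≤ F * (Fintype.card S : ℝ) ^ 2 * (Fintype.card A : ℝ) ^ 3 :=
      one_le_mul_of_one_le_of_one_le (one_le_mul_of_one_le_of_one_le hF1 (one_le_pow₀ hS))
        (one_le_pow₀ hA)
    linarith
  set lg : ℝ := Real.log (Real.exp 1 / (1 - γ)) with hlg
  have hlg1 : 1 ≤ lg := by
    rw [hlg, Real.le_log_iff_exp_le (by positivity), le_div_iff₀ hκ]
    nlinarith [Real.exp_pos 1]
  -- `G` is the argument of the logarithm in `C δ` with `ι` inserted; `480 = 16 * 30`.
  obtain ⟨G, hG⟩ : ∃ G, G = 480 * Z * (m₀ : ℝ) ^ d * lg := ⟨_, rfl⟩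
  have hGpow := CMDP.le_gap_argument_pow hZ1 hm hlg1 hG
  have hG1 : 1 < G := by
    rw [hG]
    have : 1 ≤ Z * (m₀ : ℝ) ^ d * lg := one_le_mul_of_one_le_of_one_le
      (one_le_mul_of_one_le_of_one_le hZ1 (one_le_pow₀ (by linarith))) hlg1
    nlinarith
  have hG0 : 0 < G := by linarith
  have hC0 : C δ = 72 * Real.log G := by
    rw [hC, CMDP.logFactor, hι, CMDP.gap, hG, hZ, ← hF, ← hlg, hm₀]
    congr 2
    field_simp
    rw [mul_pow]
    ring
  have hCd : C (δ / d) = 72 * Real.log (d * G) := by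
    rw [hC, CMDP.logFactor, hι, CMDP.gap, hG, hZ, ← hF, ← hlg, hm₀]
    congr 2
    field_simp
    rw [mul_pow]
    ring
  have hC0pos : 0 < C δ := by
    rw [hC0]
    have := Real.log_pos hG1
    positivity
  have hCle : C δ ≤ C (δ / d) := by
    rw [hC0, hCd]
    have : G ≤ d * G := le_mul_of_one_le_left hG0.le hd'
    gcongr
  have hCdpos : 0 < C (δ / d) := hC0pos.trans_le hCle
  have hN0 : (0 : ℝ) < N := lt_of_lt_of_le (by positivity) hN
  have hN0' : 0 < N := by exact_mod_cast hN0
  -- The index `none` stands for the perturbed reward, which lies in `[0, 2]` and is halved to fit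
  -- `[0, 1]`; this is the factor `2` in the first bound.
  let l : Option (Fin d) → (S → A → ℝ) → S → A → ℝ := fun j ξ =>
    j.elim (fun s a => 1 / 2 * (r s a + ξ s a)) c
  let CJ : Option (Fin d) → ℝ := fun j => j.elim (C δ) fun _ => C (δ / d)
  have hCJ : ∀ j, 0 < CJ j ∧ CJ j ≤ C (δ / d) := by
    rintro (_ | i)
    exacts [⟨hC0pos, hCle⟩, ⟨hCdpos, le_rfl⟩]
  let η' : Option (Fin d) → ℝ := fun j => √(CJ j / 18 * (1 / (1 - γ)) / N)
  have hη' := fun j => CMDP.sqrt_bound (N := N) hγ1 (hCJ j).1 hN0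
    (le_trans (by gcongr; exact (hCJ j).2) hN)
  let f : (Fin d → Fin (m₀ + 1)) → S → A → ℝ := fun k s a =>
    r s a + ∑ i, ((k i : ℕ) : ℝ) * ε₁ * c i s a
  have hf0 : ∀ k s a, 0 ≤ f k s a := fun k s a => add_nonneg (hr s a).1
    (Finset.sum_nonneg fun i _ => mul_nonneg (by positivity) (hc i s a).1)
  have hf : ∀ k s a, f k s a + ω ≤ F := fun k s a => by
    have h1 : ∑ i, ((k i : ℕ) : ℝ) * ε₁ * c i s a ≤ ∑ _ : Fin d, U :=
      Finset.sum_le_sum fun i _ => by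
        have h2 : ((k i : ℕ) : ℝ) ≤ m₀ := by exact_mod_cast Nat.le_of_lt_succ (k i).2
        calc ((k i : ℕ) : ℝ) * ε₁ * c i s a ≤ m₀ * ε₁ * 1 := by
              gcongr
              · exact (hc i s a).1
              · exact (hc i s a).2
          _ = U := by rw [hm₀, mul_one]
    simp only [Finset.sum_const, Finset.card_univ, Fintype.card_fin, nsmul_eq_mul] at h1
    have h3 := (hr s a).2
    simp only [f, hF]
    linarith
  have hlc : ∀ j, Continuous (l j) := by
    rintro (_ | i)
    · simp only [l, Option.elim_none]
      fun_prop
    · exact continuous_const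
  have hl : ∀ ξ : S → A → ℝ, (∀ s a, ξ s a ∈ Set.Icc 0 ω) →
      ∀ j s a, l j ξ s a ∈ Set.Icc (0 : ℝ) 1 := by
    rintro ξ hξ (_ | i) s a
    · have h1 := hr s a
      have h2 := hξ s a
      simp only [l, Option.elim_none, Set.mem_Icc] at h1 h2 ⊢
      constructor <;> linarith
    · exact hc i s a
  -- The gap used is not `ι`: it counts all `(m₀ + 1) ^ d` multipliers. `ι` enters only through `C`.
  obtain ⟨g, hg⟩ : ∃ g, g = δ * (1 - γ) * ω /
    (20 * ((m₀ : ℝ) + 1) ^ d * Fintype.card S * Fintype.card A ^ 2) := ⟨_, rfl⟩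
  have hg0 : 0 < g := by
    rw [hg]
    positivity
  have hh0 : 0 < g * (1 - γ) / 4 := by positivity
  have hgh : 2 * (g * (1 - γ) / 4) / (1 - γ) < g := by
    have : 2 * (g * (1 - γ) / 4) / (1 - γ) = g / 2 := by
      field_simp
      norm_num
    linarith
  obtain ⟨K, hK⟩ : ∃ K, K = ⌈2 * (F / (1 - γ)) / (g * (1 - γ) / 4)⌉₊ := ⟨_, rfl⟩
  have hK1 : 2 * (F / (1 - γ)) / (g * (1 - γ) / 4) ≤ K := hK ▸ Nat.le_ceil _
  have hK2 : (K : ℝ) ≤ 2 * (F / (1 - γ)) / (g * (1 - γ) / 4) + 1 :=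
    hK ▸ (Nat.ceil_lt_add_one (by positivity)).le
  have hprob := CMDP.measure_compl_goodEvent_le P hN0' hγ0 hγ1 hω0 hg0 hf0 hf hlc hl
    (ℓ := fun j => CJ j / 18) (fun j => (hη' j).1) (fun j => (hη' j).2.2.2.1)
    (fun j => (hη' j).2.1) hh0 hgh hK1
  -- The Bernstein exponent is `C / 18`, which for `C δ = 72 * log G` equals `4 * log G`.
  have hexp0 : Real.exp (-(C δ / 18)) = (G ^ 4)⁻¹ := by
    rw [hC0, Real.exp_neg, ← Real.exp_log (pow_pos hG0 4), Real.log_pow]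
    congr 2
    push_cast
    ring
  have hexp1 : Real.exp (-(C (δ / d) / 18)) = ((d * G) ^ 4)⁻¹ := by
    rw [hCd, Real.exp_neg, ← Real.exp_log (pow_pos (show 0 < d * G by positivity) 4),
      Real.log_pow]
    congr 2
    push_cast
    ring
  have hM : (Fintype.card (Fin d → Fin (m₀ + 1)) : ℝ) = ((m₀ : ℝ) + 1) ^ d := by simp
  have hfail := CMDP.failure_le hd hS hA (one_le_pow₀ (by linarith : (1 : ℝ) ≤ m₀ + 1)) hF1 hω0 hω1
    hδ0 hδ1 hκ (by linarith) hGpow hG0 hg hK2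
  rw [Fintype.sum_option, hM] at hprob
  simp only [CJ, Option.elim_none, Option.elim_some, Finset.sum_const, Finset.card_univ,
    Fintype.card_fin, nsmul_eq_mul, hexp0, hexp1] at hprob
  have hmeas := CMDP.measurableSet_goodEvent P hN0' hγ0 hγ1 ω g f hlc η'
  refine ⟨CMDP.goodEvent P N γ ω g f l η', hmeas, ?_, ?_⟩
  · have := CMDP.isProbabilityMeasure_sampleMeasure P N hω0
    have h1 := hprob.trans (ENNReal.ofReal_le_ofReal hfail)
    rw [ENNReal.ofReal_sub _ (by positivity), ENNReal.ofReal_one, tsub_le_iff_right,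
      ← prob_add_prob_compl hmeas (μ := CMDP.sampleMeasure P N ω)]
    gcongr
  · rintro x ξ ⟨hξ, hgap, hrow⟩ π lam hrun
    have hp := CMDP.isKernel_trueKernel P
    have hq := CMDP.isKernel_empKernel hN0' x
    have hρ := CMDP.toReal_mem_stdSimplex ρ
    have key : ∀ j, ∀ t < T,
        |CMDP.value (CMDP.trueKernel P) γ (π t) (l j ξ) (fun s => (ρ s).toReal) -
          CMDP.value (CMDP.empKernel x) γ (π t) (l j ξ) (fun s => (ρ s).toReal)| ≤
        √(CJ j / (N * (1 - γ) ^ 3)) := by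
      intro j t ht
      obtain ⟨k, hk⟩ := hrun.exists_lam_eq hε₁ hm₀ ht
      have hobj : (fun s a => (r s a + ξ s a) + ∑ i, lam t i * c i s a) =
          fun s a => f k s a + ξ s a := by
        funext s a
        simp only [f, hk]
        ring
      have hopt := hrun.primal t ht
      rw [hobj] at hopt
      have hm := CMDP.isGreedy_greedy (CMDP.empKernel x) γ fun s a => f k s a + ξ s a
      -- By the gap, however ties are broken, the run's policy is the greedy one, to which the row
      -- bounds apply.
      rw [hopt.eq_detPolicy hq hγ0 hγ1 hm hg0 (hgap k)]
      exact (CMDP.abs_value_detPolicy_sub_le hp hq hγ0 hγ1 (hη' j).1.le (hη' j).2.2.1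
        (hl ξ hξ j) (hrow k _ hm j) hρ).trans (hη' j).2.2.2.2
    refine ⟨CMDP.abs_mixtureValue_sub_le hT fun t ht => ?_,
      fun i => CMDP.abs_mixtureValue_sub_le hT (key (some i))⟩
    have h1 := key none t ht
    have h2 : l none ξ = (1 / 2 : ℝ) • fun s a => r s a + ξ s a := rfl
    rw [h2, CMDP.value_smul, CMDP.value_smul, ← mul_sub, abs_mul,
      abs_of_pos (by norm_num : (0 : ℝ) < 1 / 2)] at h1
    simp only [CJ, Option.elim_none] at h1
    linarith
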